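/- **Setting.** For symmetric real matrices $A_0,A_1,\dots,A_n$ of the same size put $\bar{\mathcal A}(x)=\sum_{i=1}^n x_iA_i$, $\mathcal A(x)=\bar{\mathcal A}(x)+A_0$, and let $C=\{x\in\mathbb R^n\mid \mathcal A(x)\succeq 0\}$ be the spectrahedron represented by $\mathcal A$. Write $A\cdot B$ for the trace of $AB$, $\operatorname{rec}C$ for the recession cone, $\operatorname{vert}P$ for the set of extreme points of a polyhedron $P$. A set is line-free if its recession cone $K$ satisfies $K\cap(-K)=\{0\}$. For a spectrahedron represented by $\mathcal A$ consider the programs - $(P_1(w))$: $\max w^{\mathsf T}x$ s.t. $\mathcal A(x)\succeq0$; - $(P_2(v,d))$: $\min t$ s.t. $\mathcal A(x)\succeq 0$, $x-v-td=0$; - $(D_2(v,d))$: $\max -\mathcal A(v)\cdot U$ s.t. $A_i\cdot U=w_i$ for $i=1,\dots,n$, $d^{\mathsf T}w=1$, $U\succeq0$. **Algorithm 1** (cutting scheme; input: $\mathcal A$ representing a compact spectrahedron $C\subseteq\mathbb R^n$, $n\ge1$, with nonempty interior, and $\varepsilon>0$). Compute solutions $x_w^*$ of $(P_1(w))$ for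 $w\in\{-e,e_1,\dots,e_n\}$, where $e=(1,\dots,1)^{\mathsf T}$; put $P\leftarrow\{x\mid w^{\mathsf T}x\le w^{\mathsf T}x_w^*\ \text{for all these } w\}$; choose an interior point $c$ of $C$ (for instance $c=\frac1{n+1}\sum_w x_w^*$ if this is an interior point); put $\kappa\leftarrow+\infty$. While $\kappa>\varepsilon$: compute $\operatorname{vert}P$; for every $v\in\operatorname{vert}P$ compute solutions $(x_v^*,t_v^*)$ of $(P_2(v,c-v))$ and $(U_v^*,w_v^*)$ of $(D_2(v,c-v))$; choose $\bar v\in\operatorname{vert}P$ maximizing $t_v^*\|c-v\|$; put $P\leftarrow P\cap\{x\mid w_{\bar v}^{*\mathsf T}x\ge w_{\bar v}^{*\mathsf T}\bar v+t_{\bar v}^*\}$ and $\kappa\leftarrow t_{\bar v}^*\|c-\bar v\|$. After the loop, compute and return $\operatorname{vert}P$ (representing the polytope $P$). **Algorithm 2** (input: $\mathcal A$ representing $C$, and $\varepsilon,\delta>0$). 1. $u\leftarrow(-A_1\cdot I,\dots,-A_n\cdot I)^{\mathsf T}$, $w\leftarrow u/\|u\|$. 2. $M\leftarrow\operatorname{rec}C\cap\{x\mid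 w^{\mathsf T}x=-(1+\delta)\}$. 3. Compute $\bar M$ by Algorithm 1 applied to $M$ with tolerance $\delta/2$, in Euclidean coordinates of the affine hull of $M$ and with any pencil representing $M$ there; if $M$ is a single point, $\bar M\leftarrow M$. 4. $\bar M\leftarrow\bar M+\{x\mid\|x\|_1\le\delta/2\}$. 5. $K\leftarrow\operatorname{cone}\operatorname{vert}\bar M$. 6. Compute a matrix $R$ with nonzero rows such that $K=\{x\mid Rx\le0\}$. 7. Compute a solution $x_r^*$ of $(P_1(r))$ for $C$ for every row $r$ of $R$. 8. $\bar C\leftarrow C\cap\{x\mid w^{\mathsf T}x\ge\min_r w^{\mathsf T}x_r^*-\varepsilon\}$. 9. Compute $\bar P$ by Algorithm 1 applied to $\bar C$ (with any representing pencil) and tolerance $\varepsilon$. 10. Return finite sets $V,D$ with $\operatorname{conv}V+\operatorname{cone}D=\bar P+K$. A step is a single operation of these algorithms; solving one of the programs $(P_1),(P_2),(D_2)$, enumerating the vertices of a polyhedron, and computing an $H$- or $V$-representation count as single operations, and all choices (of optimal solutions, maximizers, interior points, coordinates, representations) are arbitrary. **Corollary (finiteness of Algorithm 2).** Let $\varepsilon,\delta>0$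 and let $\mathcal A$ represent an unbounded line-free spectrahedron $C\subseteq\mathbb R^n$ with nonempty interior. Then Algorithm 2 terminates after finitely many steps: whatever choices are made, every operation can be carried out (all required solutions, finite vertex lists and representations exist), there is no infinite run, and hence every run reaches the return statement after finitely many steps. -/

import Mathlib

open scoped Pointwise

noncomputable section

namespace SpecApprox

/-- `ℝⁿ` with the Euclidean norm and inner product. -/
abbrev E (n : ℕ) : Type := EuclideanSpace ℝ (Fin n)

/-! ### Convex sets -/

/-- The recession cone of `C`. -/
def recc {n : ℕ} (C : Set (E n)) : Set (E n) :=
  {d | ∀ x ∈ C, ∀ t : ℝ, 0 ≤ t → x + t • d ∈ C}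

/-- `C` is line-free: its recession cone is pointed. -/
def LineFree {n : ℕ} (C : Set (E n)) : Prop :=
  recc C ∩ (-recc C) = {0}

/-- The conical hull of a set (it always contains the origin). -/
def coneHull {n : ℕ} (S : Set (E n)) : Set (E n) :=
  (PointedCone.hull ℝ S : Set (E n))

/-- The polyhedron `conv V + cone D` with `V`-representation `(V, D)`. -/
def vPoly {n : ℕ} (V D : List (E n)) : Set (E n) :=
  convexHull ℝ {x | x ∈ V} + coneHull {x | x ∈ D}

/-- The polyhedron `{x | aᵀ x ≤ b for all (a, b) in H}`. -/
def hPoly {n : ℕ} (H : List (E n × ℝ)) : Set (E n) :=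
  {x | ∀ h ∈ H, inner ℝ h.1 x ≤ h.2}

/-- The list `V` enumerates the vertices (extreme points) of `P`. -/
def Enumerates {n : ℕ} (V : List (E n)) (P : Set (E n)) : Prop :=
  {x | x ∈ V} = Set.extremePoints ℝ P

/-- The ball of radius `r` around `0` in the `1`-norm. -/
def oneBall (n : ℕ) (r : ℝ) : Set (E n) :=
  {x | ∑ i, |x i| ≤ r}

/-! ### Spectrahedra and the semidefinite programs -/

/-- A linear matrix pencil: symmetric `m × m` matrices `A₀, A₁, …, Aₙ`. -/
structure Pencil (n m : ℕ) where
  A₀ : Matrix (Fin m) (Fin m) ℝ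
  A : Fin n → Matrix (Fin m) (Fin m) ℝ
  symm₀ : A₀.IsSymm
  symm : ∀ i, (A i).IsSymm

namespace Pencil

variable {n m : ℕ}

/-- `𝓐(x) = x₁ A₁ + ⋯ + xₙ Aₙ + A₀`. -/
def eval (A : Pencil n m) (x : E n) : Matrix (Fin m) (Fin m) ℝ :=
  ∑ i, x i • A.A i + A.A₀

/-- The spectrahedron `{x | 𝓐(x) ⪰ 0}` represented by the pencil. -/
def spec (A : Pencil n m) : Set (E n) :=
  {x | (A.eval x).PosSemidef}

/-- `x` solves (P₁(w)): maximise `wᵀ x` over the spectrahedron. -/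
def SolP1 (A : Pencil n m) (w x : E n) : Prop :=
  x ∈ A.spec ∧ ∀ y ∈ A.spec, inner ℝ w y ≤ inner ℝ w x

/-- Feasibility for (P₂(v, d)). -/
def FeasP2 (A : Pencil n m) (v d x : E n) (t : ℝ) : Prop :=
  (A.eval x).PosSemidef ∧ x - v - t • d = 0

/-- `(x, t)` solves (P₂(v, d)): minimise `t`. -/
def SolP2 (A : Pencil n m) (v d x : E n) (t : ℝ) : Prop :=
  A.FeasP2 v d x t ∧ ∀ y s, A.FeasP2 v d y s → t ≤ s

/-- Feasibility for the Lagrangian dual (D₂(v, d)). -/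
def FeasD2 (A : Pencil n m) (d : E n) (U : Matrix (Fin m) (Fin m) ℝ) (w : E n) : Prop :=
  (∀ i, (A.A i * U).trace = w i) ∧ inner ℝ d w = 1 ∧ U.PosSemidef

/-- `(U, w)` solves (D₂(v, d)): maximise `-𝓐(v) · U`. -/
def SolD2 (A : Pencil n m) (v d : E n) (U : Matrix (Fin m) (Fin m) ℝ) (w : E n) : Prop :=
  A.FeasD2 d U w ∧
    ∀ U' w', A.FeasD2 d U' w' → -(A.eval v * U').trace ≤ -(A.eval v * U).trace

end Pencil

/-! ### The cutting scheme

The cutting scheme for a compact spectrahedron with nonempty interior is a transition system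
on the states below.  Solving one semidefinite program, and enumerating the vertices of one
polyhedron, are single steps; optimal solutions and ties are arbitrary. -/

/-- The directions `-e, e₁, …, eₙ`, with `e` the all-ones vector. -/
def directions (n : ℕ) : List (E n) :=
  WithLp.toLp 2 (fun _ => (-1 : ℝ)) :: List.ofFn (fun i => EuclideanSpace.single i (1 : ℝ))

/-- A vertex `v` with solutions `(x, t)` of (P₂(v, c - v)) and `(U, w)` of (D₂(v, c - v)). -/
structure VertexData (n m : ℕ) where
  v : E n
  x : E n
  t : ℝ
  U : Matrix (Fin m) (Fin m) ℝ
  w : E n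

/-- The states of the cutting scheme. -/
inductive CutState (n m : ℕ) : Type
  /-- Solving (P₁(w)) for the directions `w` in `todo`; `sols` holds pairs `(w, x_w)`. -/
  | init (todo : List (E n)) (sols : List (E n × E n))
  /-- At the test of the while loop: current outer approximation `P` (as a list of
  inequalities), interior point `c`, current error bound `κ`. -/
  | test (P : List (E n × ℝ)) (c : E n) (κ : EReal)
  /-- Inside the for loop over the vertices of `P`. -/
  | solve (P : List (E n × ℝ)) (c : E n) (todo : List (E n)) (sols : List (VertexData n m))
  /-- Terminated, returning the list of vertices of the final polyhedron. -/
  | done (V : List (E n))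

/-- The initial state of the cutting scheme. -/
def CutState.start (n m : ℕ) : CutState n m := .init (directions n) []

/-- One step of the cutting scheme with tolerance `ε` on the spectrahedron of `A`. -/
inductive CutStep {n m : ℕ} (A : Pencil n m) (ε : ℝ) : CutState n m → CutState n m → Prop
  | solveP1 {w x : E n} {todo : List (E n)} {sols : List (E n × E n)} (h : A.SolP1 w x) :
      CutStep A ε (.init (w :: todo) sols) (.init todo ((w, x) :: sols))
  /-- `P` is the set of `x` with `wᵀ x ≤ wᵀ x_w` for all the directions, `c` is an interior
  point (any interior point may be used; in particular the mean of the points `x_w` if that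
  happens to be one), and `κ = +∞`. -/
  | outer {sols : List (E n × E n)} {c : E n} (hc : c ∈ interior A.spec) :
      CutStep A ε (.init [] sols)
        (.test (sols.map fun s => (s.1, inner ℝ s.1 s.2)) c ⊤)
  /-- While `κ > ε`: compute the vertices of `P` and enter the for loop. -/
  | enter {P : List (E n × ℝ)} {c : E n} {κ : EReal} {V : List (E n)}
      (hκ : (ε : EReal) < κ) (hV : Enumerates V (hPoly P)) :
      CutStep A ε (.test P c κ) (.solve P c V [])
  /-- Body of the for loop for the vertex `q.v`, with `d = c - q.v`. -/
  | vertex {P : List (E n × ℝ)} {c : E n} {todo : List (E n)}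
      {sols : List (VertexData n m)} {q : VertexData n m}
      (hP : A.SolP2 q.v (c - q.v) q.x q.t) (hD : A.SolD2 q.v (c - q.v) q.U q.w) :
      CutStep A ε (.solve P c (q.v :: todo) sols) (.solve P c todo (q :: sols))
  /-- `q.v` maximises `t_v ‖c - v‖`; intersect `P` with `{x | wᵀ x ≥ wᵀ v + t_v}`, update `κ`. -/
  | cut {P : List (E n × ℝ)} {c : E n} {sols : List (VertexData n m)} {q : VertexData n m}
      (hq : q ∈ sols) (hmax : ∀ q' ∈ sols, q'.t * ‖c - q'.v‖ ≤ q.t * ‖c - q.v‖) :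
      CutStep A ε (.solve P c [] sols)
        (.test ((-q.w, -(inner ℝ q.w q.v + q.t)) :: P) c ((q.t * ‖c - q.v‖ : ℝ) : EReal))
  /-- `κ ≤ ε`: compute the vertices of `P` and return. -/
  | finish {P : List (E n × ℝ)} {c : E n} {κ : EReal} {V : List (E n)}
      (hκ : κ ≤ (ε : EReal)) (hV : Enumerates V (hPoly P)) :
      CutStep A ε (.test P c κ) (.done V)

/-! ### The algorithm for `(ε, δ)`-approximations -/

/-- The vector `(-A₁ · I, …, -Aₙ · I)`, normalised. -/
def dirW {n m : ℕ} (A : Pencil n m) : E n :=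
  let u : E n := WithLp.toLp 2 (fun i => -(A.A i * 1).trace)
  ‖u‖⁻¹ • u

/-- `M = recc C ∩ {x | wᵀ x = -(1 + δ)}`. -/
def baseM {n m : ℕ} (A : Pencil n m) (δ : ℝ) : Set (E n) :=
  recc A.spec ∩ {x | inner ℝ (dirW A) x = -(1 + δ)}

/-- The states of the algorithm. -/
inductive AlgState (n : ℕ) : Type
  | start
  /-- Running the cutting scheme on `M`, in Euclidean coordinates `φ` of its affine hull; `B`
  is a pencil representing `M` in these coordinates. -/
  | cutM {k l : ℕ} (φ : E k →ᵃⁱ[ℝ] E n) (B : Pencil k l) (s : CutState k l)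
  /-- The `δ/2`-approximation of `M` has been computed; `V` are its vertices. -/
  | approxM (V : List (E n))
  /-- The cone `K = cone D` has been computed. -/
  | cone (D : List (E n))
  /-- Solving (P₁(r)) for the rows `r` in `todo`; `sols` are the solutions found so far. -/
  | rows (D : List (E n)) (todo : List (E n)) (sols : List (E n))
  /-- Running the cutting scheme on the compact part of `C`, represented by `B`. -/
  | cutC (D : List (E n)) {l : ℕ} (B : Pencil n l) (s : CutState n l)
  /-- Terminated, returning a `V`-representation `(V, D)`. -/
  | returned (V D : List (E n))

/-- One step of the algorithm on the spectrahedron of `A` with tolerances `ε`, `δ`. -/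
inductive AlgStep {n m : ℕ} (A : Pencil n m) (ε δ : ℝ) : AlgState n → AlgState n → Prop
  /-- Start the cutting scheme on `M`, with the affine hull of `M` as the ambient space. -/
  | startM {k l : ℕ} {φ : E k →ᵃⁱ[ℝ] E n} {B : Pencil k l} (hk : 0 < k)
      (hφ : Set.range φ = (affineSpan ℝ (baseM A δ) : Set (E n)))
      (hB : B.spec = φ ⁻¹' baseM A δ) :
      AlgStep A ε δ .start (.cutM φ B (CutState.start k l))
  /-- If the affine hull of `M` has dimension `0`, then `M` is its own approximation. -/
  | pointM {x : E n} (hx : baseM A δ = {x}) :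
      AlgStep A ε δ .start (.approxM [x])
  | stepM {k l : ℕ} {φ : E k →ᵃⁱ[ℝ] E n} {B : Pencil k l} {s s' : CutState k l}
      (h : CutStep B (δ / 2) s s') :
      AlgStep A ε δ (.cutM φ B s) (.cutM φ B s')
  | endM {k l : ℕ} {φ : E k →ᵃⁱ[ℝ] E n} {B : Pencil k l} {V : List (E k)} :
      AlgStep A ε δ (.cutM φ B (.done V)) (.approxM (V.map φ))
  /-- Add the `1`-norm ball of radius `δ/2` and compute the vertices `D` of the result. -/
  | enlarge {V D : List (E n)}
      (hD : Enumerates D (convexHull ℝ {x | x ∈ V} + oneBall n (δ / 2))) :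
      AlgStep A ε δ (.approxM V) (.cone D)
  /-- Compute an `H`-representation `(R, 0)` of `K = cone D`. -/
  | hrep {D R : List (E n)} (hR₀ : ∀ r ∈ R, r ≠ 0)
      (hR : {x : E n | ∀ r ∈ R, inner ℝ r x ≤ 0} = coneHull {x | x ∈ D}) :
      AlgStep A ε δ (.cone D) (.rows D R [])
  | solveRow {D todo sols : List (E n)} {r x : E n} (h : A.SolP1 r x) :
      AlgStep A ε δ (.rows D (r :: todo) sols) (.rows D todo (x :: sols))
  /-- With `β = min_r wᵀ x_r`, start the cutting scheme on `C ∩ {x | wᵀ x ≥ β - ε}`. -/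
  | startC {D sols : List (E n)} {β : ℝ} {l : ℕ} {B : Pencil n l}
      (hβ : IsLeast {b | ∃ x ∈ sols, b = inner ℝ (dirW A) x} β)
      (hB : B.spec = A.spec ∩ {x | β - ε ≤ inner ℝ (dirW A) x}) :
      AlgStep A ε δ (.rows D [] sols) (.cutC D B (CutState.start n l))
  | stepC {D : List (E n)} {l : ℕ} {B : Pencil n l} {s s' : CutState n l}
      (h : CutStep B ε s s') :
      AlgStep A ε δ (.cutC D B s) (.cutC D B s')
  /-- Return a `V`-representation of `P̄ + K`. -/
  | ret {D V V' D' : List (E n)} {l : ℕ} {B : Pencil n l}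
      (h : vPoly V' D' = vPoly V D) :
      AlgStep A ε δ (.cutC D B (.done V)) (.returned V' D')

end SpecApprox

end

open scoped Pointwise

noncomputable section

namespace SpecApprox

/-! ### Polyhedra -/

section Polyhedra

variable {n : ℕ}

/-! Algorithm 2 is a fixed sequence of operations apart from its calls of the cutting scheme, so two
facts are needed: every operation can be carried out, and every call of the cutting scheme stops.

The cutting scheme stops by a packing argument. If the ball of radius `r` around `c` lies in the
spectrahedron, the normal `w` of the cut at `v` satisfies `r * ‖w‖ ≤ 1 - t`
(`Pencil.SolP2.norm_mul_le`). A point `y` surviving the cut has `⟨w, y - v⟩ ≥ t`, hence lies at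
distance at least `r * t` from `v`, and this is at least `ε * r / D` if `t * ‖c - v‖ > ε` and `‖c -
v‖ ≤ D` (`le_dist_of_mem_cut`). Later vertices survive all earlier cuts, so the cut vertices form a
separated family in a compact simplex, and there are finitely many (`terminates_test`). Validity of
the cuts is strong duality (`Pencil.SolP2.exists_feasD2`): minimality of `t` produces a kernel
vector of 𝓐(x) from which a rank-one dual solution is built. 𝓐(c) may be singular, so any
representing pencil is allowed.

The remaining solvability rests on `inner_dirW_neg`: for line-free `C`, the vector `dirW A` is
negative on all nonzero recession directions. Hence `M` and the truncation of `C` are compact. The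
cutting scheme returns an outer approximation of `M`; enlarging it by a ball puts every nonzero
recession direction in the interior of `K`, so each row of `R` is strictly negative on these
directions and (P₁(r)) has compact upper level sets. Since `K` stays in a half-space, `R` has a row
and the minimum over the rows exists. -/

theorem convex_hPoly (H : List (E n × ℝ)) : Convex ℝ (hPoly H) := by
  intro x hx y hy a b ha hb hab h hh
  have h1 := mul_le_mul_of_nonneg_left (hx h hh) ha
  have h2 := mul_le_mul_of_nonneg_left (hy h hh) hb
  rw [inner_add_right, inner_smul_right, inner_smul_right]
  calc _ ≤ a * h.2 + b * h.2 := add_le_add h1 h2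
    _ = h.2 := by rw [← add_mul, hab, one_mul]

theorem isClosed_hPoly (H : List (E n × ℝ)) : IsClosed (hPoly H) := by
  have : hPoly H = ⋂ h ∈ H, {x | inner ℝ h.1 x ≤ h.2} := by
    ext x; simp [hPoly]
  rw [this]
  exact isClosed_biInter fun h _ => isClosed_le (by fun_prop) continuous_const

/-- A point of a polyhedron can be moved a little in both directions along `d` as long as `d` is
orthogonal to the normals of the constraints active at the point. -/
theorem exists_pos_add_smul_mem_hPoly {H : List (E n × ℝ)} {x d : E n} (hx : x ∈ hPoly H)
    (hd : ∀ h ∈ H, inner ℝ h.1 x = h.2 → inner ℝ h.1 d = 0) :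
    ∃ s : ℝ, 0 < s ∧ x + s • d ∈ hPoly H ∧ x - s • d ∈ hPoly H := by
  have key : ∀ᶠ s : ℝ in nhds 0, ∀ h ∈ {h | h ∈ H},
      inner ℝ h.1 (x + s • d) ≤ h.2 ∧ inner ℝ h.1 (x - s • d) ≤ h.2 := by
    rw [Filter.eventually_all_finite (List.finite_toSet H)]
    intro h hh
    rcases (hx h hh).lt_or_eq with hlt | heq
    · have c1 : Continuous fun s : ℝ => inner ℝ h.1 (x + s • d) := by fun_prop
      have c2 : Continuous fun s : ℝ => inner ℝ h.1 (x - s • d) := by fun_prop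
      have e1 : ∀ᶠ s : ℝ in nhds 0, inner ℝ h.1 (x + s • d) < h.2 :=
        c1.continuousAt.eventually_lt continuousAt_const (by simpa using hlt)
      have e2 : ∀ᶠ s : ℝ in nhds 0, inner ℝ h.1 (x - s • d) < h.2 :=
        c2.continuousAt.eventually_lt continuousAt_const (by simpa using hlt)
      filter_upwards [e1, e2] with s h1 h2 using ⟨h1.le, h2.le⟩
    · refine Filter.Eventually.of_forall fun s => ?_
      rw [inner_add_right, inner_sub_right, inner_smul_right, hd h hh heq]
      simp [heq]
  obtain ⟨r, hr, hball⟩ := Metric.eventually_nhds_iff.1 key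
  have h2 := hball (y := r / 2) (by
    rw [Real.dist_eq, sub_zero, abs_of_pos (by positivity)]; linarith)
  exact ⟨r / 2, by positivity, fun h hh => (h2 h hh).1, fun h hh => (h2 h hh).2⟩

/-- An extreme point is determined by its active constraints: if those active at `x` are also active
at `y`, then `x` can be moved both ways along `y - x`. -/
theorem finite_extremePoints_hPoly (H : List (E n × ℝ)) :
    (Set.extremePoints ℝ (hPoly H)).Finite := by
  let f : E n → Set (E n × ℝ) := fun x => {h | h ∈ H ∧ inner ℝ h.1 x = h.2}
  refine Set.Finite.of_finite_image (f := f) ?_ ?_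
  · refine ((List.finite_toSet H).powerset).subset ?_
    rintro _ ⟨x, -, rfl⟩ h hh
    exact hh.1
  · intro x hx y hy hxy
    obtain ⟨s, hs, h1, h2⟩ := exists_pos_add_smul_mem_hPoly (d := y - x) hx.1 (by
      intro h hh hxh
      have : h ∈ f y := by rw [← hxy]; exact ⟨hh, hxh⟩
      rw [inner_sub_right, this.2, hxh, sub_self])
    have hmem : x ∈ openSegment ℝ (x + s • (y - x)) (x - s • (y - x)) :=
      ⟨1 / 2, 1 / 2, by norm_num, by norm_num, by norm_num, by module⟩
    have h3 := hx.2 h1 h2 hmem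
    have h4 : s • (y - x) = 0 := by simpa using h3
    rcases smul_eq_zero.1 h4 with h | h
    · exact absurd h hs.ne'
    · exact (sub_eq_zero.1 h).symm

theorem exists_enumerates {P : Set (E n)} (h : (Set.extremePoints ℝ P).Finite) :
    ∃ V : List (E n), Enumerates V P :=
  ⟨h.toFinset.toList, by ext x; simp⟩

/-- A compact convex set with finitely many vertices is their convex hull. -/
theorem Enumerates.convexHull_eq {P : Set (E n)} {V : List (E n)} (hV : Enumerates V P)
    (hc : IsCompact P) (hconv : Convex ℝ P) : convexHull ℝ {x | x ∈ V} = P := by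
  have h1 := closure_convexHull_extremePoints hc hconv
  rw [← hV] at h1
  rwa [IsClosed.closure_eq] at h1
  exact (List.finite_toSet V).isClosed_convexHull ℝ

/-- The sum of two polytopes has finitely many vertices. -/
theorem finite_extremePoints_convexHull_add {S T : Set (E n)} (hS : S.Finite) (hT : T.Finite) :
    (Set.extremePoints ℝ (convexHull ℝ S + convexHull ℝ T)).Finite := by
  rw [← convexHull_add]
  exact (hS.add hT).subset extremePoints_convexHull_subset

end Polyhedra

/-! ### The ball of the `1`-norm -/

section OneBall

variable {n : ℕ}

/-- The sum of absolute values is the largest signed sum, attained at the sign pattern of `x`. This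
makes the ball an intersection of `2 ^ n` half-spaces. -/
theorem sum_abs_le_iff (x : Fin n → ℝ) (r : ℝ) :
    ∑ i, |x i| ≤ r ↔ ∀ σ : Fin n → Bool, ∑ i, (if σ i then 1 else -1) * x i ≤ r := by
  constructor
  · intro h σ
    refine (Finset.sum_le_sum fun i _ => ?_).trans h
    split_ifs
    · simpa using le_abs_self (x i)
    · simpa using neg_le_abs (x i)
  · intro h
    refine le_trans (le_of_eq (Finset.sum_congr rfl fun i _ => ?_)) (h fun i => decide (0 ≤ x i))
    by_cases hi : 0 ≤ x i
    · simp [hi, abs_of_nonneg hi]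
    · simp [hi, abs_of_neg (not_le.1 hi)]

theorem exists_oneBall_eq_hPoly (n : ℕ) (r : ℝ) : ∃ H : List (E n × ℝ), oneBall n r = hPoly H := by
  refine ⟨(Finset.univ : Finset (Fin n → Bool)).toList.map
    fun σ => (WithLp.toLp 2 fun i => if σ i then (1 : ℝ) else -1, r), ?_⟩
  ext x
  rw [oneBall, Set.mem_ofPred_eq, sum_abs_le_iff]
  simp [hPoly, PiLp.inner_apply, mul_comm]

theorem norm_le_of_mem_oneBall {r : ℝ} {x : E n} (hx : x ∈ oneBall n r) : ‖x‖ ≤ r := by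
  refine le_trans ?_ hx
  rw [EuclideanSpace.norm_eq]
  refine Real.sqrt_le_iff.2 ⟨Finset.sum_nonneg fun i _ => abs_nonneg _, ?_⟩
  simp only [Real.norm_eq_abs]
  exact Finset.sum_sq_le_sq_sum_of_nonneg fun i _ => abs_nonneg _

theorem convex_oneBall (n : ℕ) (r : ℝ) : Convex ℝ (oneBall n r) := by
  obtain ⟨H, hH⟩ := exists_oneBall_eq_hPoly n r
  rw [hH]; exact convex_hPoly H

theorem isCompact_oneBall (n : ℕ) (r : ℝ) : IsCompact (oneBall n r) := by
  obtain ⟨H, hH⟩ := exists_oneBall_eq_hPoly n r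
  refine Metric.isCompact_of_isClosed_isBounded (hH ▸ isClosed_hPoly H) ?_
  refine (Metric.isBounded_closedBall (x := (0 : E n)) (r := r)).subset fun x hx => ?_
  simpa using norm_le_of_mem_oneBall hx

theorem exists_pos_smul_mem_oneBall {r : ℝ} (hr : 0 < r) (x : E n) :
    ∃ s : ℝ, 0 < s ∧ s • x ∈ oneBall n r := by
  have h0 : 0 ≤ ∑ i, |x i| := Finset.sum_nonneg fun i _ => abs_nonneg _
  -- The summand `1` keeps the denominator positive when `x = 0`.
  refine ⟨r / (∑ i, |x i| + 1), by positivity, ?_⟩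
  have h1 : ∑ i, |((r / (∑ i, |x i| + 1)) • x) i| = r / (∑ i, |x i| + 1) * ∑ i, |x i| := by
    rw [Finset.mul_sum]
    refine Finset.sum_congr rfl fun i _ => ?_
    rw [PiLp.smul_apply, smul_eq_mul, abs_mul, abs_of_pos (by positivity)]
  rw [oneBall, Set.mem_ofPred_eq, h1, div_mul_eq_mul_div, div_le_iff₀ (by positivity)]
  nlinarith

theorem finite_extremePoints_convexHull_add_oneBall (V : List (E n)) (r : ℝ) :
    (Set.extremePoints ℝ (convexHull ℝ {x | x ∈ V} + oneBall n r)).Finite := by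
  obtain ⟨H, hH⟩ := exists_oneBall_eq_hPoly n r
  have hfin : (Set.extremePoints ℝ (oneBall n r)).Finite := hH ▸ finite_extremePoints_hPoly H
  obtain ⟨W, hW⟩ := exists_enumerates hfin
  rw [← hW.convexHull_eq (isCompact_oneBall n r) (convex_oneBall n r)]
  exact finite_extremePoints_convexHull_add (List.finite_toSet V) (List.finite_toSet W)

end OneBall

/-! ### Finitely generated cones are polyhedral -/

section Cones

variable {n : ℕ}

theorem exists_mem_le_forall_le {L U : Set ℝ} (hL : L.Finite) (hne : L.Nonempty)
    (h : ∀ l ∈ L, ∀ u ∈ U, l ≤ u) : ∃ t, (∀ l ∈ L, l ≤ t) ∧ ∀ u ∈ U, t ≤ u := by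
  obtain ⟨t, ht, hmax⟩ := hL.exists_maximalFor id L hne
  refine ⟨t, fun l hl => ?_, h t ht⟩
  rcases le_total l t with h' | h'
  · exact h'
  · exact hmax hl h'

/-- Fourier–Motzkin elimination of the coefficient of one generator. -/
theorem exists_finite_polar_add_ray {R : Set (E n)} (hR : R.Finite) (d : E n) :
    ∃ R' : Set (E n), R'.Finite ∧ ∀ y : E n,
      (∀ r ∈ R', inner ℝ r y ≤ 0) ↔ ∃ t : ℝ, 0 ≤ t ∧ ∀ r ∈ R, inner ℝ r (y - t • d) ≤ 0 := by
  -- `M` holds the positive combinations of two constraints in which the coefficient of `t` cancels.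
  -- `N` includes the constraints with negative product with `d`, since `t` is also bounded below by
  -- `0`.
  let N : Set (E n) := {r ∈ R | inner ℝ r d ≤ 0}
  let M : Set (E n) := (fun p : E n × E n => (-inner ℝ p.2 d) • p.1 + (inner ℝ p.1 d) • p.2) ''
    ({r ∈ R | 0 < inner ℝ r d} ×ˢ {s ∈ R | inner ℝ s d < 0})
  refine ⟨N ∪ M, ?_, fun y => ⟨fun h => ?_, ?_⟩⟩
  · exact (hR.subset (Set.sep_subset _ _)).union
      (((hR.subset (Set.sep_subset _ _)).prod (hR.subset (Set.sep_subset _ _))).image _)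
  -- Constraints with positive product with `d` bound `t` from below, those with negative product
  -- from above; `0` is a further lower bound.
  · obtain ⟨t, h1, h2⟩ := exists_mem_le_forall_le
      (L := insert 0 ((fun r : E n => inner ℝ r y / inner ℝ r d) '' {r ∈ R | 0 < inner ℝ r d}))
      (U := (fun r : E n => inner ℝ r y / inner ℝ r d) '' {r ∈ R | inner ℝ r d < 0})
      (((hR.subset (Set.sep_subset _ _)).image _).insert _) (Set.insert_nonempty _ _) (by
        rintro l (rfl | ⟨r, ⟨hr, hrd⟩, rfl⟩) _ ⟨s, ⟨hs, hsd⟩, rfl⟩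
        · exact div_nonneg_of_nonpos (h s (Or.inl ⟨hs, hsd.le⟩)) hsd.le
        · have h3 := h _ (Or.inr ⟨(r, s), ⟨⟨hr, hrd⟩, ⟨hs, hsd⟩⟩, rfl⟩)
          simp only [inner_add_left, real_inner_smul_left] at h3
          show inner ℝ r y / inner ℝ r d ≤ inner ℝ s y / inner ℝ s d
          rw [div_le_iff₀ hrd, div_mul_eq_mul_div, le_div_iff_of_neg hsd]
          linarith)
    refine ⟨t, h1 0 (Set.mem_insert _ _), fun r hr => ?_⟩
    rw [inner_sub_right, inner_smul_right]
    rcases lt_trichotomy (inner ℝ r d) 0 with h0 | h0 | h0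
    · have := h2 _ ⟨r, ⟨hr, h0⟩, rfl⟩
      have := (le_div_iff_of_neg h0).1 this
      linarith
    · have := h r (Or.inl ⟨hr, h0.le⟩)
      rw [h0]; linarith
    · have := h1 _ (Or.inr ⟨r, ⟨hr, h0⟩, rfl⟩)
      have := (div_le_iff₀ h0).1 this
      linarith
  · rintro ⟨t, ht, h⟩ r hr
    have h' : ∀ r ∈ R, inner ℝ r y ≤ t * inner ℝ r d := fun r hr => by
      have := h r hr
      rw [inner_sub_right, inner_smul_right] at this
      linarith
    rcases hr with ⟨hr, hrd⟩ | ⟨⟨r, s⟩, ⟨⟨hr, hrd⟩, ⟨hs, hsd⟩⟩, rfl⟩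
    · exact (h' r hr).trans (mul_nonpos_of_nonneg_of_nonpos ht hrd)
    · simp only [inner_add_left, real_inner_smul_left]
      simp only at hrd hsd
      nlinarith [mul_le_mul_of_nonneg_left (h' r hr) (neg_nonneg.2 hsd.le),
        mul_le_mul_of_nonneg_left (h' s hs) hrd.le]

theorem mem_coneHull_insert {S : Set (E n)} {d y : E n} :
    y ∈ coneHull (insert d S) ↔ ∃ t : ℝ, 0 ≤ t ∧ y - t • d ∈ coneHull S := by
  unfold coneHull PointedCone.hull
  rw [SetLike.mem_coe, Submodule.mem_span_insert]
  constructor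
  · rintro ⟨t, z, hz, rfl⟩
    refine ⟨t, t.2, ?_⟩
    have : t • d + z - (t : ℝ) • d = z := by
      show (t : ℝ) • d + z - (t : ℝ) • d = z
      abel
    rwa [this]
  · rintro ⟨t, ht, h⟩
    refine ⟨⟨t, ht⟩, _, h, ?_⟩
    show y = t • d + _
    abel

/-- Finitely generated cones have a finite description by linear inequalities. -/
theorem exists_finite_polar_coneHull {S : Set (E n)} (hS : S.Finite) :
    ∃ R : Set (E n), R.Finite ∧ {x : E n | ∀ r ∈ R, inner ℝ r x ≤ 0} = coneHull S := by
  induction S, hS using Set.Finite.induction_on with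
  | empty =>
    refine ⟨Set.range (fun i => EuclideanSpace.single i (1 : ℝ)) ∪
      Set.range (fun i => EuclideanSpace.single i (-1 : ℝ)),
      (Set.finite_range _).union (Set.finite_range _), ?_⟩
    ext x
    simp only [coneHull, PointedCone.hull, Submodule.span_empty]
    constructor
    · intro h
      show x = 0
      ext i
      have h1 := h _ (Or.inl ⟨i, rfl⟩)
      have h2 := h _ (Or.inr ⟨i, rfl⟩)
      simp only [EuclideanSpace.inner_single_left] at h1 h2
      simp at h1 h2 ⊢
      linarith
    · intro h r _
      have : x = 0 := h
      simp [this]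
  | @insert d S _ _ ih =>
    obtain ⟨R, hR, hRS⟩ := ih
    obtain ⟨R', hR', h⟩ := exists_finite_polar_add_ray hR d
    refine ⟨R', hR', ?_⟩
    ext y
    rw [mem_coneHull_insert, Set.mem_ofPred_eq, h y, ← hRS]
    rfl

/-- A zero normal imposes no condition and can be dropped. Nonzero rows are what later yields strict
inequalities on recession directions. -/
theorem exists_list_polar_coneHull (D : List (E n)) :
    ∃ R : List (E n), (∀ r ∈ R, r ≠ 0) ∧
      {x : E n | ∀ r ∈ R, inner ℝ r x ≤ 0} = coneHull {x | x ∈ D} := by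
  obtain ⟨R, hR, h⟩ := exists_finite_polar_coneHull (List.finite_toSet D)
  have hR' : (R \ {0}).Finite := hR.subset Set.sdiff_subset
  refine ⟨hR'.toFinset.toList, by simp, ?_⟩
  rw [← h]
  ext x
  simp only [Finset.mem_toList, Set.Finite.mem_toFinset, Set.mem_ofPred_eq]
  refine ⟨fun hx r hr => ?_, fun hx r hr => hx r hr.1⟩
  by_cases h0 : r = 0
  · simp [h0]
  · exact hx r ⟨hr, h0⟩

theorem convexHull_subset_coneHull (S : Set (E n)) : convexHull ℝ S ⊆ coneHull S :=
  convexHull_min Submodule.subset_span (PointedCone.hull ℝ S).convex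

end Cones

/-! ### Unbounded closed convex sets and separated families -/

section Topology

variable {V : Type*} [NormedAddCommGroup V] [NormedSpace ℝ V]

/-- An unbounded closed convex set contains a ray from each of its points. -/
theorem exists_ray_of_not_isBounded [ProperSpace V] {S : Set V} (hS : IsClosed S)
    (hconv : Convex ℝ S) (hb : ¬ Bornology.IsBounded S) {x₀ : V} (hx₀ : x₀ ∈ S) :
    ∃ d : V, d ≠ 0 ∧ ∀ t : ℝ, 0 ≤ t → x₀ + t • d ∈ S := by
  have h1 : ∀ k : ℕ, ∃ x ∈ S, (k : ℝ) < ‖x - x₀‖ := by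
    intro k
    by_contra! h
    exact hb ((Metric.isBounded_closedBall (x := x₀) (r := k)).subset fun x hx => by
      simpa [dist_eq_norm] using h x hx)
  choose x hxS hx using h1
  have hpos : ∀ k, 0 < ‖x k - x₀‖ := fun k => lt_of_le_of_lt (Nat.cast_nonneg k) (hx k)
  let u : ℕ → V := fun k => ‖x k - x₀‖⁻¹ • (x k - x₀)
  have hu : ∀ k, u k ∈ Metric.sphere (0 : V) 1 := fun k => by
    simp [u, norm_smul, inv_mul_cancel₀ (hpos k).ne']
  obtain ⟨d, hd, φ, hφ, hlim⟩ := (isCompact_sphere (0 : V) 1).tendsto_subseq hu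
  refine ⟨d, fun h0 => by simp [h0] at hd, fun t ht => ?_⟩
  have hl : Filter.Tendsto (fun k => x₀ + t • u (φ k)) Filter.atTop (nhds (x₀ + t • d)) :=
    (hlim.const_smul t).const_add x₀
  refine hS.mem_of_tendsto hl ?_
  obtain ⟨k₀, hk₀⟩ := exists_nat_gt t
  filter_upwards [Filter.eventually_ge_atTop k₀] with k hk
  -- Once `x (φ k)` is farther than `t` from `x₀`, the point `x₀ + t • u (φ k)` lies on the segment
  -- between them.
  have hle : t ≤ ‖x (φ k) - x₀‖ := by
    have : (k₀ : ℝ) ≤ φ k := by exact_mod_cast hk.trans (hφ.id_le k)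
    linarith [hx (φ k)]
  have := hconv.add_smul_sub_mem hx₀ (hxS (φ k)) (t := t * ‖x (φ k) - x₀‖⁻¹)
    ⟨by positivity, by rw [← div_eq_mul_inv]; exact div_le_one_of_le₀ hle (norm_nonneg _)⟩
  rwa [mul_smul] at this

/-- The number of points of a separated family in a compact set is bounded. -/
theorem exists_length_le_of_pairwise_dist {X : Type*} [PseudoMetricSpace X] {K : Set X}
    (hK : IsCompact K) {η : ℝ} (hη : 0 < η) :
    ∃ N : ℕ, ∀ L : List X, (∀ x ∈ L, x ∈ K) → L.Pairwise (fun x y => η ≤ dist x y) →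
      L.length ≤ N := by
  obtain ⟨t, ht, hcov⟩ := Metric.totallyBounded_iff.1 hK.totallyBounded (η / 2) (by positivity)
  refine ⟨ht.toFinset.card, fun L hL hsep => ?_⟩
  have h1 : ∀ x : X, ∃ y, x ∈ K → y ∈ t ∧ dist x y < η / 2 := fun x => by
    by_cases hx : x ∈ K
    · obtain ⟨y, hy, hxy⟩ := Set.mem_iUnion₂.1 (hcov hx)
      exact ⟨y, fun _ => ⟨hy, hxy⟩⟩
    · exact ⟨x, fun h => absurd h hx⟩
  -- Assigning to each point the centre of a covering ball of radius `η / 2` is injective on a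
  -- separated family.
  choose f hf using h1
  have hnodup : (L.map f).Nodup := by
    rw [List.nodup_iff_pairwise_ne, List.pairwise_map]
    refine hsep.imp_of_mem fun {x y} hx hy hxy heq => ?_
    have h2 := (hf x (hL x hx)).2
    have h3 := (hf y (hL y hy)).2
    rw [heq] at h2
    linarith [dist_triangle_right x y (f y)]
  classical
  rw [← List.length_map f, ← List.toFinset_card_of_nodup hnodup]
  refine Finset.card_le_card fun y hy => ?_
  obtain ⟨x, hx, rfl⟩ := List.mem_map.1 (List.mem_toFinset.1 hy)
  exact ht.mem_toFinset.2 (hf x (hL x hx)).1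

end Topology

/-! ### Positive semidefinite matrices -/

section PosSemidef

open Matrix

variable {m : ℕ}

theorem posSemidef_iff_of_isSymm {M : Matrix (Fin m) (Fin m) ℝ} (hM : M.IsSymm) :
    M.PosSemidef ↔ ∀ z : Fin m → ℝ, 0 ≤ z ⬝ᵥ (M *ᵥ z) := by
  rw [posSemidef_iff_dotProduct_mulVec]
  simp only [star_trivial]
  refine and_iff_right ?_
  rw [Matrix.IsHermitian, conjTranspose_eq_transpose_of_trivial]
  exact hM

theorem PosSemidef.isSymm {M : Matrix (Fin m) (Fin m) ℝ} (hM : M.PosSemidef) : M.IsSymm := by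
  have h := hM.isHermitian
  rwa [Matrix.IsHermitian, conjTranspose_eq_transpose_of_trivial] at h

open scoped MatrixOrder Matrix.Norms.L2Operator in
-- Writing `U = Bᴴ B` turns the trace into that of the congruent matrix `B M Bᴴ`.
theorem trace_mul_nonneg_of_posSemidef {M U : Matrix (Fin m) (Fin m) ℝ} (hM : M.PosSemidef)
    (hU : U.PosSemidef) : 0 ≤ (M * U).trace := by
  obtain ⟨B, rfl⟩ := CStarAlgebra.nonneg_iff_eq_star_mul_self.mp hU.nonneg
  rw [← Matrix.mul_assoc, Matrix.trace_mul_comm, ← Matrix.mul_assoc, star_eq_conjTranspose]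
  exact (hM.mul_mul_conjTranspose_same B).trace_nonneg

/-- A symmetric perturbation whose kernel contains the kernel of a positive semidefinite matrix
may be subtracted from it with a small positive factor. -/
theorem exists_pos_posSemidef_sub_smul {P Q : Matrix (Fin m) (Fin m) ℝ} (hP : P.PosSemidef)
    (hQ : Q.IsSymm) (hker : ∀ z, P *ᵥ z = 0 → Q *ᵥ z = 0) :
    ∃ s : ℝ, 0 < s ∧ (P - s • Q).PosSemidef := by
  -- On a complement of the kernel the form of `P` is positive definite, so compactness of the unit
  -- sphere there bounds it below by some `μ > 0` and the form of `Q` above. The kernel itself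
  -- contributes nothing to either form.
  obtain ⟨W, hW⟩ := Submodule.exists_isCompl (LinearMap.ker P.mulVecLin)
  let K : Set (Fin m → ℝ) := Metric.sphere 0 1 ∩ W
  have hK : IsCompact K := (isCompact_sphere _ _).inter_right W.closed_of_finiteDimensional
  have cP : Continuous fun z : Fin m → ℝ => z ⬝ᵥ (P *ᵥ z) := by fun_prop
  have cQ : Continuous fun z : Fin m → ℝ => z ⬝ᵥ (Q *ᵥ z) := by fun_prop
  have hpos : ∀ z ∈ K, 0 < z ⬝ᵥ (P *ᵥ z) := by
    rintro z ⟨hz1, hzW⟩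
    have h0 : 0 ≤ z ⬝ᵥ (P *ᵥ z) := by simpa using hP.dotProduct_mulVec_nonneg z
    refine lt_of_le_of_ne h0 fun h => ?_
    have hz : P *ᵥ z = 0 := (hP.dotProduct_mulVec_zero_iff z).1 (by simpa using h.symm)
    have : z = 0 := by
      have := hW.disjoint.le_bot (show z ∈ LinearMap.ker P.mulVecLin ⊓ W from ⟨hz, hzW⟩)
      simpa using this
    simp [this] at hz1
  obtain ⟨μ, hμ, hμK⟩ : ∃ μ > 0, ∀ z ∈ K, μ ≤ z ⬝ᵥ (P *ᵥ z) := by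
    rcases K.eq_empty_or_nonempty with he | hne
    · exact ⟨1, one_pos, by simp [he]⟩
    · obtain ⟨z, hz, hmin⟩ := hK.exists_isMinOn hne cP.continuousOn
      exact ⟨_, hpos z hz, fun y hy => hmin hy⟩
  obtain ⟨C, hC⟩ := hK.exists_bound_of_continuousOn cQ.continuousOn
  have hC' : 0 < |C| + 1 := by positivity
  refine ⟨μ / (|C| + 1), by positivity, ?_⟩
  have hsymm : (P - (μ / (|C| + 1)) • Q).IsSymm := (PosSemidef.isSymm hP).sub (hQ.smul _)
  rw [posSemidef_iff_of_isSymm hsymm]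
  have onK : ∀ z ∈ K, 0 ≤ z ⬝ᵥ ((P - (μ / (|C| + 1)) • Q) *ᵥ z) := by
    intro z hz
    rw [sub_mulVec, smul_mulVec, dotProduct_sub, dotProduct_smul, smul_eq_mul]
    have h1 := hμK z hz
    have h2 : z ⬝ᵥ (Q *ᵥ z) ≤ |C| + 1 :=
      ((le_abs_self _).trans (hC z hz)).trans ((le_abs_self C).trans (by linarith))
    have h3 : μ / (|C| + 1) * (z ⬝ᵥ (Q *ᵥ z)) ≤ μ / (|C| + 1) * (|C| + 1) := by gcongr
    rw [div_mul_cancel₀ _ hC'.ne'] at h3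
    linarith
  intro z
  obtain ⟨k, hk, y, hy, rfl⟩ : ∃ k ∈ LinearMap.ker P.mulVecLin, ∃ y ∈ W, k + y = z :=
    Submodule.mem_sup.1 (hW.sup_eq_top ▸ Submodule.mem_top)
  have hPk : P *ᵥ k = 0 := hk
  have hMk : (P - (μ / (|C| + 1)) • Q) *ᵥ k = 0 := by
    rw [sub_mulVec, smul_mulVec, hPk, hker k hPk]; simp
  have hkM : ∀ u, k ⬝ᵥ ((P - (μ / (|C| + 1)) • Q) *ᵥ u) = 0 := by
    intro u
    rw [dotProduct_mulVec, ← mulVec_transpose, hsymm.eq, hMk, zero_dotProduct]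
  rw [mulVec_add, hMk, zero_add, add_dotProduct, hkM, zero_add]
  by_cases hy0 : y = 0
  · simp [hy0]
  have hn : 0 < ‖y‖ := norm_pos_iff.2 hy0
  have := onK (‖y‖⁻¹ • y) ⟨by simp [norm_smul, hn.ne'], W.smul_mem _ hy⟩
  rw [mulVec_smul, dotProduct_smul, smul_dotProduct, smul_smul, smul_eq_mul] at this
  exact nonneg_of_mul_nonneg_right this (by positivity)

end PosSemidef

/-! ### Pencils and their spectrahedra -/

namespace Pencil

open Matrix

variable {n m : ℕ} (A : Pencil n m)

/-- The linear part `x₁ A₁ + ⋯ + xₙ Aₙ` of a pencil. -/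
def lin (x : E n) : Matrix (Fin m) (Fin m) ℝ := ∑ i, x i • A.A i

theorem eval_eq (x : E n) : A.eval x = A.lin x + A.A₀ := rfl

theorem lin_add (x y : E n) : A.lin (x + y) = A.lin x + A.lin y := by
  simp [lin, add_smul, Finset.sum_add_distrib]

theorem lin_smul (t : ℝ) (x : E n) : A.lin (t • x) = t • A.lin x := by
  simp [lin, mul_smul, Finset.smul_sum]

theorem lin_neg (x : E n) : A.lin (-x) = -A.lin x := by
  rw [← neg_one_smul ℝ x, lin_smul, neg_one_smul]

theorem eval_add_smul (x d : E n) (t : ℝ) : A.eval (x + t • d) = A.eval x + t • A.lin d := by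
  rw [eval_eq, eval_eq, lin_add, lin_smul]; abel

theorem isSymm_lin (x : E n) : (A.lin x).IsSymm := by
  rw [Matrix.IsSymm, lin, transpose_sum]
  exact Finset.sum_congr rfl fun i _ => by rw [transpose_smul, (A.symm i).eq]

theorem isSymm_eval (x : E n) : (A.eval x).IsSymm := (A.isSymm_lin x).add A.symm₀

theorem mem_spec_iff {x : E n} : x ∈ A.spec ↔ ∀ z : Fin m → ℝ, 0 ≤ z ⬝ᵥ (A.eval x *ᵥ z) :=
  posSemidef_iff_of_isSymm (A.isSymm_eval x)

theorem continuous_eval : Continuous A.eval := by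
  unfold eval; fun_prop

theorem isClosed_spec : IsClosed A.spec := by
  have : A.spec = ⋂ z : Fin m → ℝ, {x | 0 ≤ z ⬝ᵥ (A.eval x *ᵥ z)} := by
    ext x; simpa using A.mem_spec_iff
  rw [this]
  refine isClosed_iInter fun z => isClosed_le continuous_const ?_
  have := A.continuous_eval
  fun_prop

theorem convex_spec : Convex ℝ A.spec := by
  intro x hx y hy a b ha hb hab
  have h : A.eval (a • x + b • y) = a • A.eval x + b • A.eval y := by
    rw [eval_eq, lin_add, lin_smul, lin_smul, eval_eq, eval_eq, smul_add, smul_add]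
    have : A.A₀ = a • A.A₀ + b • A.A₀ := by rw [← add_smul, hab, one_smul]
    nth_rw 1 [this]
    abel
  show (A.eval _).PosSemidef
  rw [h]
  exact (PosSemidef.smul hx ha).add (PosSemidef.smul hy hb)

/-! #### Recession directions -/

theorem posSemidef_lin_of_ray {x d : E n} (h : ∀ t : ℝ, 0 ≤ t → x + t • d ∈ A.spec) :
    (A.lin d).PosSemidef := by
  rw [posSemidef_iff_of_isSymm (A.isSymm_lin d)]
  intro z
  by_contra! hz
  set b := z ⬝ᵥ (A.lin d *ᵥ z)
  set a := z ⬝ᵥ (A.eval x *ᵥ z)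
  have ht : ∀ t : ℝ, 0 ≤ t → 0 ≤ a + t * b := fun t ht => by
    have := A.mem_spec_iff.1 (h t ht) z
    rwa [eval_add_smul, add_mulVec, smul_mulVec, dotProduct_add, dotProduct_smul,
      smul_eq_mul] at this
  -- At this `t` the value `a + t * b` is `a - |a| - 1`, which is negative.
  have := ht ((|a| + 1) / -b) (div_nonneg (by positivity) (by linarith))
  have e : (|a| + 1) / -b * b = -(|a| + 1) := by
    rw [div_neg, neg_mul, div_mul_cancel₀ _ hz.ne]
  rw [e] at this
  linarith [le_abs_self a]

/-- The recession cone is thus itself a spectrahedron, so its base can be fed to the cutting scheme.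
Nonemptiness matters: every vector recedes from the empty set. -/
theorem mem_recc_spec_iff (hne : A.spec.Nonempty) {d : E n} :
    d ∈ recc A.spec ↔ (A.lin d).PosSemidef := by
  constructor
  · intro h
    obtain ⟨x, hx⟩ := hne
    exact A.posSemidef_lin_of_ray (h x hx)
  · intro h x hx t ht
    show (A.eval _).PosSemidef
    rw [eval_add_smul]
    exact PosSemidef.add hx (h.smul ht)

/-- The part of a spectrahedron above a hyperplane is compact if the normal of the hyperplane is
negative on the nonzero recession directions. -/
theorem isCompact_spec_inter {f : E n} (hf : ∀ d, d ≠ 0 → (A.lin d).PosSemidef → inner ℝ f d < 0)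
    (b : ℝ) : IsCompact (A.spec ∩ {x | b ≤ inner ℝ f x}) := by
  have hcl : IsClosed (A.spec ∩ {x | b ≤ inner ℝ f x}) :=
    A.isClosed_spec.inter (isClosed_le continuous_const (by fun_prop))
  refine Metric.isCompact_of_isClosed_isBounded hcl ?_
  by_contra hb
  have hconv : Convex ℝ (A.spec ∩ {x | b ≤ inner ℝ f x}) :=
    A.convex_spec.inter (convex_halfSpace_ge (innerSL ℝ f).toLinearMap.isLinear b)
  obtain ⟨x, hx⟩ : (A.spec ∩ {x | b ≤ inner ℝ f x}).Nonempty := by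
    by_contra h
    rw [Set.not_nonempty_iff_eq_empty] at h
    exact hb (h ▸ Bornology.isBounded_empty)
  obtain ⟨d, hd0, hd⟩ := exists_ray_of_not_isBounded hcl hconv hb hx
  have hneg := hf d hd0 (A.posSemidef_lin_of_ray fun t ht => (hd t ht).1)
  have ht : ∀ t : ℝ, 0 ≤ t → b ≤ inner ℝ f x + t * inner ℝ f d := fun t ht => by
    have : b ≤ inner ℝ f (x + t • d) := (hd t ht).2
    rwa [inner_add_right, inner_smul_right] at this
  have hxb : b ≤ inner ℝ f x := hx.2
  have := ht ((inner ℝ f x - b + 1) / -inner ℝ f d) (div_nonneg (by linarith) (by linarith))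
  have e : (inner ℝ f x - b + 1) / -inner ℝ f d * inner ℝ f d = -(inner ℝ f x - b + 1) := by
    rw [div_neg, neg_mul, div_mul_cancel₀ _ hneg.ne]
  rw [e] at this
  linarith

/-! #### Solvability of the programs -/

/-- Only the upper level set at one feasible point has to be compact, so this applies to unbounded
spectrahedra. -/
theorem exists_solP1 {f : E n} {x₀ : E n} (hx₀ : x₀ ∈ A.spec)
    (hc : IsCompact (A.spec ∩ {x | inner ℝ f x₀ ≤ inner ℝ f x})) : ∃ x, A.SolP1 f x := by
  obtain ⟨x, hx, hmax⟩ := hc.exists_isMaxOn (f := fun x => inner ℝ f x)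
    ⟨x₀, hx₀, le_refl (inner ℝ f x₀)⟩ (by fun_prop)
  refine ⟨x, hx.1, fun y hy => ?_⟩
  rcases le_total (inner ℝ f x₀) (inner ℝ f y) with h | h
  · exact hmax ⟨hy, h⟩
  · exact h.trans hx.2

theorem exists_solP1_of_isCompact (hc : IsCompact A.spec) (hne : A.spec.Nonempty) (f : E n) :
    ∃ x, A.SolP1 f x := by
  obtain ⟨x₀, hx₀⟩ := hne
  exact A.exists_solP1 hx₀ (hc.inter_right (isClosed_le continuous_const (by fun_prop)))

theorem feasP2_iff {v d x : E n} {t : ℝ} :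
    A.FeasP2 v d x t ↔ x = v + t • d ∧ v + t • d ∈ A.spec := by
  constructor
  · rintro ⟨h1, h2⟩
    have : x = v + t • d := by
      rw [sub_sub, sub_eq_zero] at h2; exact h2
    exact ⟨this, this ▸ h1⟩
  · rintro ⟨rfl, h⟩
    exact ⟨h, by abel⟩

/-- The line through `v` and `c` meets the compact spectrahedron in a compact set of parameters,
which contains `1` because `c` is feasible. -/
theorem exists_solP2 (hc : IsCompact A.spec) {v c : E n} (hcs : c ∈ A.spec) (hne : v ≠ c) :
    ∃ x t, A.SolP2 v (c - v) x t := by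
  have hd : 0 < ‖c - v‖ := norm_pos_iff.2 (sub_ne_zero.2 hne.symm)
  let T : Set ℝ := {t | v + t • (c - v) ∈ A.spec}
  have hT : IsCompact T := by
    refine Metric.isCompact_of_isClosed_isBounded (A.isClosed_spec.preimage (by fun_prop)) ?_
    obtain ⟨R, hR⟩ := hc.isBounded.exists_norm_le
    refine (Metric.isBounded_closedBall (x := (0 : ℝ)) (r := (R + ‖v‖) / ‖c - v‖)).subset ?_
    intro t ht
    rw [mem_closedBall_zero_iff, le_div_iff₀ hd, ← norm_smul]
    have h1 := hR _ ht
    calc ‖t • (c - v)‖ = ‖(v + t • (c - v)) - v‖ := by rw [add_sub_cancel_left]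
      _ ≤ ‖v + t • (c - v)‖ + ‖v‖ := norm_sub_le _ _
      _ ≤ R + ‖v‖ := by linarith
  have h1T : (1 : ℝ) ∈ T := by simpa [T] using hcs
  obtain ⟨t, ht, hmin⟩ := hT.exists_isLeast ⟨1, h1T⟩
  refine ⟨_, t, A.feasP2_iff.2 ⟨rfl, ht⟩, fun y s hs => hmin (A.feasP2_iff.1 hs).2⟩

theorem trace_eval_mul {U : Matrix (Fin m) (Fin m) ℝ} {w : E n}
    (hw : ∀ i, (A.A i * U).trace = w i) (x : E n) :
    (A.eval x * U).trace = inner ℝ w x + (A.A₀ * U).trace := by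
  rw [eval, Matrix.add_mul, trace_add, Finset.sum_mul, trace_sum, PiLp.inner_apply]
  congr 1
  refine Finset.sum_congr rfl fun i _ => ?_
  rw [Matrix.smul_mul, trace_smul, hw]
  simp

theorem trace_lin_mul {U : Matrix (Fin m) (Fin m) ℝ} {w : E n}
    (hw : ∀ i, (A.A i * U).trace = w i) (x : E n) : (A.lin x * U).trace = inner ℝ w x := by
  have := A.trace_eval_mul hw x
  rw [eval_eq, Matrix.add_mul, trace_add] at this
  linarith

/-- The half-space of a feasible point of (D₂) contains the spectrahedron. -/
theorem FeasD2.inner_ge {A : Pencil n m} {d w : E n} {U : Matrix (Fin m) (Fin m) ℝ}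
    (h : A.FeasD2 d U w) (v : E n) {x : E n} (hx : x ∈ A.spec) :
    inner ℝ w v + -(A.eval v * U).trace ≤ inner ℝ w x := by
  have h1 := A.trace_eval_mul h.1 x
  have h2 := A.trace_eval_mul h.1 v
  have h3 := trace_mul_nonneg_of_posSemidef hx h.2.2
  linarith

theorem weak_duality {A : Pencil n m} {v d w x : E n} {t : ℝ} {U : Matrix (Fin m) (Fin m) ℝ}
    (hP : A.FeasP2 v d x t) (hD : A.FeasD2 d U w) : -(A.eval v * U).trace ≤ t := by
  have h := hD.inner_ge v hP.1
  have h1 : inner ℝ w d = 1 := by rw [real_inner_comm]; exact hD.2.1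
  rw [(A.feasP2_iff.1 hP).1, inner_add_right, inner_smul_right, h1] at h
  linarith

theorem SolP2.lt_one {A : Pencil n m} {v c x : E n} {t : ℝ} (h : A.SolP2 v (c - v) x t)
    (hc : c ∈ interior A.spec) : t < 1 := by
  have hcont : Continuous fun s : ℝ => v + s • (c - v) := by fun_prop
  have hev : ∀ᶠ s : ℝ in nhds 1, v + s • (c - v) ∈ A.spec :=
    hcont.continuousAt.eventually_mem (by simpa using mem_interior_iff_mem_nhds.1 hc)
  obtain ⟨r, hr, hball⟩ := Metric.eventually_nhds_iff.1 hev
  have h2 := hball (y := 1 - r / 2) (by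
    rw [Real.dist_eq, sub_sub_cancel_left, abs_neg, abs_of_pos (by positivity)]; linarith)
  have := h.2 _ _ (A.feasP2_iff.2 ⟨rfl, h2⟩)
  linarith

/-- Strong duality: (D₂) has a feasible point of the optimal value of (P₂). -/
theorem SolP2.exists_feasD2 {A : Pencil n m} {v c x : E n} {t : ℝ}
    (h : A.SolP2 v (c - v) x t) (hc : c ∈ interior A.spec) :
    ∃ U w, A.FeasD2 (c - v) U w ∧ -(A.eval v * U).trace = t := by
  have ht := h.lt_one hc
  have hcS : c ∈ A.spec := interior_subset hc
  have hcP : (A.eval c).PosSemidef := hcS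
  obtain ⟨hx, hxS⟩ := A.feasP2_iff.1 h.1
  have hxP : (A.eval x).PosSemidef := h.1.1
  have hcx : A.eval c = A.eval x + (1 - t) • A.lin (c - v) := by
    rw [← eval_add_smul, hx]; congr 1; module
  -- If no such `z` existed, the kernel of 𝓐(x) would lie in that of `A.lin (c - v)`, and a small
  -- multiple of the latter could be subtracted from 𝓐(x), lowering `t` below its minimum.
  obtain ⟨z, hz, hcz⟩ : ∃ z, A.eval x *ᵥ z = 0 ∧ A.eval c *ᵥ z ≠ 0 := by
    by_contra! hno
    obtain ⟨s, hs, hPS⟩ := exists_pos_posSemidef_sub_smul hxP (A.isSymm_lin (c - v)) (by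
      intro z hz
      have h1 := hno z hz
      rw [hcx, add_mulVec, hz, zero_add, smul_mulVec] at h1
      exact (smul_eq_zero.1 h1).resolve_left (by linarith))
    have : v + (t - s) • (c - v) ∈ A.spec := by
      show (A.eval _).PosSemidef
      have e : v + (t - s) • (c - v) = x + (-s) • (c - v) := by rw [hx]; module
      rw [e, eval_add_smul, neg_smul, ← sub_eq_add_neg]
      exact hPS
    have := h.2 _ _ (A.feasP2_iff.2 ⟨rfl, this⟩)
    linarith
  have hqc : 0 < z ⬝ᵥ (A.eval c *ᵥ z) := by
    have h0 : 0 ≤ z ⬝ᵥ (A.eval c *ᵥ z) := by simpa using hcP.dotProduct_mulVec_nonneg z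
    exact lt_of_le_of_ne h0 fun h =>
      hcz ((hcP.dotProduct_mulVec_zero_iff z).1 (by simpa using h.symm))
  have hqd : 0 < z ⬝ᵥ (A.lin (c - v) *ᵥ z) := by
    rw [hcx, add_mulVec, hz, zero_add, smul_mulVec, dotProduct_smul, smul_eq_mul] at hqc
    exact pos_of_mul_pos_right hqc (by linarith)
  set a := z ⬝ᵥ (A.lin (c - v) *ᵥ z) with ha
  -- The factor `a⁻¹` enforces the normalisation `⟨c - v, w⟩ = 1`; since `z` is in the kernel of
  -- 𝓐(x), complementary slackness holds and the dual value is `t`.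
  let U : Matrix (Fin m) (Fin m) ℝ := a⁻¹ • vecMulVec z z
  have hU : U.PosSemidef := by
    have := posSemidef_vecMulVec_self_star z
    rw [star_trivial] at this
    exact this.smul (by positivity)
  have htr : ∀ M : Matrix (Fin m) (Fin m) ℝ, (M * U).trace = a⁻¹ * (z ⬝ᵥ (M *ᵥ z)) := by
    intro M
    rw [Matrix.mul_smul, trace_smul, smul_eq_mul, mul_vecMulVec, trace_vecMulVec, dotProduct_comm]
  let w : E n := WithLp.toLp 2 fun i => (A.A i * U).trace
  have hw : ∀ i, (A.A i * U).trace = w i := fun i => rfl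
  have hdw : (A.lin (c - v) * U).trace = 1 := by
    rw [htr, ← ha, inv_mul_cancel₀ hqd.ne']
  refine ⟨U, w, ⟨hw, ?_, hU⟩, ?_⟩
  · rw [real_inner_comm, ← A.trace_lin_mul hw, hdw]
  · have h1 : (A.eval x * U).trace = 0 := by rw [htr, hz]; simp
    have h2 : A.eval x = A.eval v + t • A.lin (c - v) := by rw [hx, eval_add_smul]
    rw [h2, Matrix.add_mul, trace_add, Matrix.smul_mul, trace_smul, hdw, smul_eq_mul] at h1
    linarith

theorem SolP2.exists_solD2 {A : Pencil n m} {v c x : E n} {t : ℝ}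
    (h : A.SolP2 v (c - v) x t) (hc : c ∈ interior A.spec) :
    ∃ U w, A.SolD2 v (c - v) U w := by
  obtain ⟨U, w, hf, hv⟩ := h.exists_feasD2 hc
  exact ⟨U, w, hf, fun U' w' h' => (weak_duality h.1 h').trans hv.ge⟩

/-- The cut of a vertex is valid for the spectrahedron. -/
theorem SolP2.inner_ge {A : Pencil n m} {v c x w : E n} {t : ℝ} {U : Matrix (Fin m) (Fin m) ℝ}
    (h : A.SolP2 v (c - v) x t) (hD : A.SolD2 v (c - v) U w) (hc : c ∈ interior A.spec)
    {y : E n} (hy : y ∈ A.spec) : inner ℝ w v + t ≤ inner ℝ w y := by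
  obtain ⟨U', w', hf, hv⟩ := h.exists_feasD2 hc
  have h1 := hD.2 U' w' hf
  have h2 := hD.1.inner_ge v hy
  linarith

/-- The normal of the cut of a vertex is bounded in terms of a ball around the interior point. -/
theorem SolP2.norm_mul_le {A : Pencil n m} {v c x w : E n} {t r : ℝ}
    {U : Matrix (Fin m) (Fin m) ℝ} (h : A.SolP2 v (c - v) x t) (hD : A.SolD2 v (c - v) U w)
    (hc : c ∈ interior A.spec) (hr : 0 ≤ r) (hball : Metric.closedBall c r ⊆ A.spec) :
    r * ‖w‖ ≤ 1 - t := by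
  have hdw : inner ℝ w c - inner ℝ w v = 1 := by
    rw [← inner_sub_right, real_inner_comm]; exact hD.1.2.1
  have hw : 0 < ‖w‖ := by
    rw [norm_pos_iff]; rintro rfl; simp at hdw
  -- The cut is tested at the point of the ball where `w` is smallest.
  have hmem : c - (r * ‖w‖⁻¹) • w ∈ A.spec := hball (by
    rw [mem_closedBall_iff_norm, sub_sub_cancel_left, norm_neg, norm_smul, Real.norm_eq_abs,
      abs_of_nonneg (by positivity), mul_assoc, inv_mul_cancel₀ hw.ne', mul_one])
  have h1 := h.inner_ge hD hc hmem
  rw [inner_sub_right, inner_smul_right, real_inner_self_eq_norm_sq] at h1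
  have e : r * ‖w‖⁻¹ * ‖w‖ ^ 2 = r * ‖w‖ := by field_simp
  rw [e] at h1
  linarith

end Pencil

/-! ### Termination of transition systems -/

/-- Every run of `step` from a state ends after finitely many steps, in a state with `final`. -/
inductive Terminates {α : Type*} (step : α → α → Prop) (final : α → Prop) : α → Prop
  | intro {s : α} (progress : final s ∨ ∃ s', step s s')
      (next : ∀ s', step s s' → Terminates step final s') : Terminates step final s

namespace Terminates

variable {α : Type*} {step : α → α → Prop} {final : α → Prop}

theorem not_exists_run {s₀ : α} (h : Terminates step final s₀) :
    ¬ ∃ s : ℕ → α, s 0 = s₀ ∧ ∀ i, step (s i) (s (i + 1)) := by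
  induction h with
  | intro _ _ ih =>
    rintro ⟨s, rfl, hs⟩
    exact ih (s 1) (hs 0) ⟨fun i => s (i + 1), rfl, fun i => hs (i + 1)⟩

theorem final_or_step_of_reflTransGen {s₀ s : α} (h : Terminates step final s₀)
    (hs : Relation.ReflTransGen step s₀ s) : final s ∨ ∃ s', step s s' := by
  have : Terminates step final s := by
    induction hs with
    | refl => exact h
    | tail _ hstep ih => obtain ⟨_, hn⟩ := ih; exact hn _ hstep
  obtain ⟨hp, _⟩ := this
  exact hp

end Terminates

/-! ### Termination of the cutting scheme -/

section Cutting

variable {k l : ℕ}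

/-- The simplex described by the directions `-e, e₁, …, eₙ`. -/
theorem isCompact_hPoly_of_directions {H : List (E k × ℝ)}
    (h : ∀ d ∈ directions k, ∃ b, (d, b) ∈ H) : IsCompact (hPoly H) := by
  refine Metric.isCompact_of_isClosed_isBounded (isClosed_hPoly H) ?_
  obtain ⟨b₀, hb₀⟩ := h (WithLp.toLp 2 fun _ => (-1 : ℝ)) (by simp [directions])
  have h1 : ∀ i, ∃ b, (EuclideanSpace.single i (1 : ℝ), b) ∈ H := fun i =>
    h _ (List.mem_cons_of_mem _ (by rw [List.mem_ofFn]; exact ⟨i, rfl⟩))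
  choose b hb using h1
  refine (Metric.isBounded_closedBall (x := (WithLp.toLp 2 b : E k))
    (r := ∑ i, b i + b₀)).subset fun x hx => ?_
  have hx0 : -∑ i, x i ≤ b₀ := by
    simpa [PiLp.inner_apply] using hx _ hb₀
  have hxi : ∀ i, x i ≤ b i := fun i => by
    simpa [EuclideanSpace.inner_single_left] using hx _ (hb i)
  rw [Metric.mem_closedBall, dist_comm, dist_eq_norm]
  refine norm_le_of_mem_oneBall ?_
  -- All coordinates of `b - x` are nonnegative, so its 1-norm is linear in `x` and is controlled by
  -- the constraint with normal `-e`.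
  have h2 : ∑ i, |((WithLp.toLp 2 b : E k) - x) i| = ∑ i, b i - ∑ i, x i := by
    rw [← Finset.sum_sub_distrib]
    exact Finset.sum_congr rfl fun i _ => abs_of_nonneg (sub_nonneg.2 (hxi i))
  rw [oneBall, Set.mem_ofPred_eq, h2]
  linarith

variable {B : Pencil k l} {ε : ℝ}

/-- A final state of the cutting scheme: the returned vertices span an outer approximation. -/
def CutState.IsOuter (B : Pencil k l) (s : CutState k l) : Prop :=
  ∃ V, s = .done V ∧ B.spec ⊆ convexHull ℝ {x | x ∈ V}

theorem terminates_test_of_le {P : List (E k × ℝ)} {c : E k} {κ : EReal} (hκ : κ ≤ (ε : EReal))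
    (hP : IsCompact (hPoly P)) (hBP : B.spec ⊆ hPoly P) :
    Terminates (CutStep B ε) (CutState.IsOuter B) (.test P c κ) := by
  refine .intro (Or.inr ?_) ?_
  · obtain ⟨V, hV⟩ := exists_enumerates (finite_extremePoints_hPoly P)
    exact ⟨_, .finish hκ hV⟩
  · rintro _ (_ | _ | ⟨hκ', _⟩ | _ | _ | ⟨_, hV⟩)
    · exact absurd hκ (not_le.2 hκ')
    · refine .intro (Or.inl ⟨_, rfl, ?_⟩) ?_
      · rwa [hV.convexHull_eq hP (convex_hPoly P)]
      · rintro _ ⟨⟩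

/-- `hnext` covers every possible cut, since the choice of the maximiser plays no role in
termination. The last disjunction ensures that a maximiser exists when the vertices are exhausted.
-/
theorem terminates_solve {P : List (E k × ℝ)} {c : E k} (hk : 0 < k) (hB : IsCompact B.spec)
    (hc : c ∈ interior B.spec) (hBP : B.spec ⊆ hPoly P)
    (hnext : ∀ q : VertexData k l, q.v ∈ hPoly P → B.SolP2 q.v (c - q.v) q.x q.t →
      B.SolD2 q.v (c - q.v) q.U q.w → Terminates (CutStep B ε) (CutState.IsOuter B)
        (.test ((-q.w, -(inner ℝ q.w q.v + q.t)) :: P) c ((q.t * ‖c - q.v‖ : ℝ) : EReal)))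
    (todo : List (E k)) : ∀ (sols : List (VertexData k l)),
    (∀ v ∈ todo, v ∈ Set.extremePoints ℝ (hPoly P)) →
    (∀ q ∈ sols, q.v ∈ hPoly P ∧ B.SolP2 q.v (c - q.v) q.x q.t ∧
      B.SolD2 q.v (c - q.v) q.U q.w) →
    (todo ≠ [] ∨ sols ≠ []) →
    Terminates (CutStep B ε) (CutState.IsOuter B) (.solve P c todo sols) := by
  induction todo with
  | nil =>
    intro sols _ hsols hne
    refine .intro (Or.inr ?_) ?_
    · obtain ⟨q, hq, hmax⟩ := (List.finite_toSet sols).exists_maximalFor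
        (fun q => q.t * ‖c - q.v‖) _ (List.exists_mem_of_ne_nil sols (by simpa using hne))
      refine ⟨_, .cut (q := q) hq fun q' hq' => ?_⟩
      rcases le_total (q'.t * ‖c - q'.v‖) (q.t * ‖c - q.v‖) with h | h
      · exact h
      · exact hmax hq' h
    · rintro _ (_ | _ | _ | _ | ⟨hq, _⟩ | _)
      obtain ⟨h1, h2, h3⟩ := hsols _ hq
      exact hnext _ h1 h2 h3
  | cons v todo ih =>
    intro sols htodo hsols _
    have hv := htodo v List.mem_cons_self
    refine .intro (Or.inr ?_) ?_
    · have : Nonempty (Fin k) := ⟨⟨0, hk⟩⟩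
      -- In positive dimension an extreme point is never interior, whereas `c` is interior to the
      -- polyhedron.
      have hvc : v ≠ c := by
        rintro rfl
        exact (disjoint_interior_extremePoints (hPoly P)).le_bot
          ⟨interior_mono hBP hc, hv⟩
      obtain ⟨x, t, hxt⟩ := B.exists_solP2 hB (interior_subset hc) hvc
      obtain ⟨U, w, hUw⟩ := hxt.exists_solD2 hc
      exact ⟨_, .vertex (q := ⟨v, x, t, U, w⟩) hxt hUw⟩
    · rintro _ (_ | _ | _ | ⟨hP, hD⟩ | _ | _)
      refine ih _ (fun v hv => htodo v (List.mem_cons_of_mem _ hv)) ?_ (Or.inr (by simp))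
      intro q hq
      rcases List.mem_cons.1 hq with rfl | hq
      · exact ⟨hv.1, hP, hD⟩
      · exact hsols q hq

/-- Points that survive the cut of a vertex keep a distance from it. -/
theorem le_dist_of_mem_cut {c v w x y : E k} {t r D : ℝ} {U : Matrix (Fin l) (Fin l) ℝ}
    (hε : 0 < ε) (hP : B.SolP2 v (c - v) x t) (hD : B.SolD2 v (c - v) U w)
    (hc : c ∈ interior B.spec) (hr : 0 < r) (hball : Metric.closedBall c r ⊆ B.spec)
    (hDpos : 0 < D) (hdist : ‖c - v‖ ≤ D) (hκ : ε < t * ‖c - v‖)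
    (hy : inner ℝ w v + t ≤ inner ℝ w y) : ε * r / D ≤ dist y v := by
  have ht : 0 < t := by
    by_contra! h
    linarith [mul_nonpos_of_nonpos_of_nonneg h (norm_nonneg (c - v))]
  have h1 := hP.norm_mul_le hD hc hr.le hball
  have h2 : ε < t * D := hκ.trans_le (by gcongr)
  have h3 : t ≤ ‖w‖ * dist y v := by
    have := real_inner_le_norm w (y - v)
    rw [inner_sub_right] at this
    rw [dist_eq_norm]
    linarith
  have h4 : r * t ≤ dist y v := by
    have : r * t ≤ r * ‖w‖ * dist y v := by
      rw [mul_assoc]; gcongr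
    nlinarith [dist_nonneg (x := y) (y := v)]
  rw [div_le_iff₀ hDpos]
  nlinarith

theorem terminates_test {c : E k} (hk : 0 < k) (hB : IsCompact B.spec) (hε : 0 < ε)
    (hc : c ∈ interior B.spec) {P₀ : List (E k × ℝ)} (hP₀ : IsCompact (hPoly P₀))
    (hBP₀ : B.spec ⊆ hPoly P₀) (κ : EReal) :
    Terminates (CutStep B ε) (CutState.IsOuter B) (.test P₀ c κ) := by
  obtain ⟨r, hr, hball⟩ : ∃ r > 0, Metric.closedBall c r ⊆ B.spec :=
    Metric.nhds_basis_closedBall.mem_iff.1 (mem_interior_iff_mem_nhds.1 hc)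
  obtain ⟨D, hDpos, hD⟩ : ∃ D > 0, ∀ v ∈ hPoly P₀, ‖c - v‖ ≤ D := by
    obtain ⟨R, hR⟩ := hP₀.isBounded.exists_norm_le
    refine ⟨‖c‖ + |R| + 1, by positivity, fun v hv => ?_⟩
    linarith [norm_sub_le c v, hR v hv, le_abs_self R]
  obtain ⟨N, hN⟩ := exists_length_le_of_pairwise_dist hP₀ (show 0 < ε * r / D by positivity)
  -- `L` collects the vertices cut off so far, from which all of `hPoly P` keeps its distance; `j`
  -- bounds the cuts that remain before the packing number `N` is exceeded.
  have key : ∀ (j : ℕ) (P : List (E k × ℝ)) (κ : EReal) (L : List (E k)),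
      hPoly P ⊆ hPoly P₀ → B.spec ⊆ hPoly P → (∀ x ∈ L, x ∈ hPoly P₀) →
      L.Pairwise (fun x y => ε * r / D ≤ dist x y) →
      (∀ y ∈ hPoly P, ∀ v ∈ L, ε * r / D ≤ dist y v) → N < L.length + j →
      Terminates (CutStep B ε) (CutState.IsOuter B) (.test P c κ) := by
    intro j
    induction j with
    | zero =>
      intro P κ L _ _ hL hsep _ hlt
      exact absurd (hN L hL hsep) (not_le.2 hlt)
    | succ j ih =>
      intro P κ L hPP hBP hL hsep hdist hlt
      have hPc : IsCompact (hPoly P) := hP₀.of_isClosed_subset (isClosed_hPoly P) hPP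
      rcases le_or_gt κ (ε : EReal) with hκ | hκ
      · exact terminates_test_of_le hκ hPc hBP
      refine .intro (Or.inr ?_) ?_
      · obtain ⟨V, hV⟩ := exists_enumerates (finite_extremePoints_hPoly P)
        exact ⟨_, .enter hκ hV⟩
      rintro _ (_ | _ | @⟨_, _, _, V, _, hV⟩ | _ | _ | ⟨hκ', _⟩)
      swap
      · exact absurd hκ (not_lt.2 hκ')
      refine terminates_solve hk hB hc hBP ?_ V [] ?_ (by simp) (Or.inl ?_)
      · intro q hqv hqP hqD
        have hsub : hPoly ((-q.w, -(inner ℝ q.w q.v + q.t)) :: P) ⊆ hPoly P :=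
          fun x hx h hh => hx h (List.mem_cons_of_mem _ hh)
        have hcut : ∀ y ∈ hPoly ((-q.w, -(inner ℝ q.w q.v + q.t)) :: P),
            inner ℝ q.w q.v + q.t ≤ inner ℝ q.w y := fun y hy => by
          have := hy _ List.mem_cons_self
          rw [inner_neg_left] at this
          exact neg_le_neg_iff.1 this
        have hBcut : B.spec ⊆ hPoly ((-q.w, -(inner ℝ q.w q.v + q.t)) :: P) := by
          intro y hy h hh
          rcases List.mem_cons.1 hh with rfl | hh
          · rw [inner_neg_left]
            exact neg_le_neg (hqP.inner_ge hqD hc hy)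
          · exact hBP hy h hh
        rcases le_or_gt (q.t * ‖c - q.v‖) ε with hle | hgt
        · exact terminates_test_of_le (by exact_mod_cast hle)
            (hPc.of_isClosed_subset (isClosed_hPoly _) hsub) hBcut
        · refine ih _ _ (q.v :: L) (hsub.trans hPP) hBcut ?_ ?_ ?_ ?_
          · intro x hx
            rcases List.mem_cons.1 hx with rfl | hx
            · exact hPP hqv
            · exact hL x hx
          · exact List.pairwise_cons.2 ⟨fun v hv => hdist _ hqv v hv, hsep⟩
          · intro y hy v hv
            rcases List.mem_cons.1 hv with rfl | hv
            · exact le_dist_of_mem_cut hε hqP hqD hc hr hball hDpos (hD _ (hPP hqv)) hgt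
                (hcut y hy)
            · exact hdist y (hsub hy) v hv
          · rw [List.length_cons]; omega
      · intro v hv
        rw [← hV]; exact hv
      -- A nonempty compact set has an extreme point, so the vertex list is not empty.
      · rintro rfl
        obtain ⟨v, hv⟩ := hPc.extremePoints_nonempty ⟨c, hBP (interior_subset hc)⟩
        rw [← hV] at hv
        simp at hv
  exact key (N + 1) P₀ κ [] subset_rfl hBP₀ (by simp) (by simp) (by simp) (by simp)

/-- The cutting scheme terminates on a compact spectrahedron with nonempty interior and returns
the vertices of an outer approximation. -/
theorem terminates_start (hk : 0 < k) (hB : IsCompact B.spec) (hint : (interior B.spec).Nonempty)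
    (hε : 0 < ε) : Terminates (CutStep B ε) (CutState.IsOuter B) (CutState.start k l) := by
  have key : ∀ (todo : List (E k)) (sols : List (E k × E k)),
      (∀ s ∈ sols, B.SolP1 s.1 s.2) → (∀ d ∈ directions k, d ∈ todo ∨ ∃ x, (d, x) ∈ sols) →
      Terminates (CutStep B ε) (CutState.IsOuter B) (.init todo sols) := by
    intro todo
    induction todo with
    | nil =>
      intro sols hsols hdir
      refine .intro (Or.inr ?_) ?_
      · obtain ⟨c, hc⟩ := hint
        exact ⟨_, .outer hc⟩
      · rintro _ (_ | ⟨hc⟩ | _ | _ | _ | _)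
        refine terminates_test hk hB hε hc (isCompact_hPoly_of_directions fun d hd => ?_) ?_ _
        · obtain ⟨x, hx⟩ := (hdir d hd).resolve_left (by simp)
          exact ⟨inner ℝ d x, List.mem_map.2 ⟨(d, x), hx, rfl⟩⟩
        · intro y hy h hh
          obtain ⟨s, hs, rfl⟩ := List.mem_map.1 hh
          exact (hsols s hs).2 y hy
    | cons w todo ih =>
      intro sols hsols hdir
      refine .intro (Or.inr ?_) ?_
      · obtain ⟨x, hx⟩ := B.exists_solP1_of_isCompact hB (hint.mono interior_subset) w
        exact ⟨_, .solveP1 hx⟩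
      · rintro _ (@⟨_, x, _, _, hx⟩ | _ | _ | _ | _ | _)
        refine ih _ ?_ ?_
        · intro s hs
          rcases List.mem_cons.1 hs with rfl | hs
          · exact hx
          · exact hsols s hs
        · intro d hd
          rcases hdir d hd with h | ⟨y, hy⟩
          · rcases List.mem_cons.1 h with rfl | h
            · exact Or.inr ⟨x, List.mem_cons_self⟩
            · exact Or.inl h
          · exact Or.inr ⟨y, List.mem_cons_of_mem _ hy⟩
  exact key _ _ (by simp) fun d hd => Or.inl hd

end Cutting

/-! ### Constructions of pencils -/

section Blocks

open Matrix

theorem posSemidef_fromBlocks_zero_iff {ι κ : Type*} [Fintype ι] [Fintype κ]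
    {P : Matrix ι ι ℝ} {Q : Matrix κ κ ℝ} :
    (fromBlocks P 0 0 Q).PosSemidef ↔ P.PosSemidef ∧ Q.PosSemidef := by
  constructor
  · intro h
    exact ⟨h.submatrix Sum.inl, h.submatrix Sum.inr⟩
  · rintro ⟨hP, hQ⟩
    refine .of_dotProduct_mulVec_nonneg (hP.1.fromBlocks (by simp) hQ.1) fun z => ?_
    have h1 := hP.dotProduct_mulVec_nonneg (z ∘ Sum.inl)
    have h2 := hQ.dotProduct_mulVec_nonneg (z ∘ Sum.inr)
    rw [fromBlocks_mulVec]
    simp only [zero_mulVec, add_zero, zero_add, star_trivial] at *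
    rw [← Sum.elim_comp_inl_inr z, sumElim_dotProduct_sumElim]
    simpa using add_nonneg h1 h2

end Blocks

namespace Pencil

open Matrix

variable {n m : ℕ}

/-- The pencil of the intersection of a spectrahedron with a half-space `{x | b ≤ fᵀ x}`. -/
def interHalfSpace (A : Pencil n m) (f : E n) (b : ℝ) : Pencil n (m + 1) where
  A₀ := (fromBlocks A.A₀ 0 0 (diagonal fun _ : Fin 1 => -b)).submatrix
    finSumFinEquiv.symm finSumFinEquiv.symm
  A i := (fromBlocks (A.A i) 0 0 (diagonal fun _ : Fin 1 => f i)).submatrix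
    finSumFinEquiv.symm finSumFinEquiv.symm
  symm₀ := (A.symm₀.fromBlocks (by simp) (isSymm_diagonal _)).submatrix _
  symm i := ((A.symm i).fromBlocks (by simp) (isSymm_diagonal _)).submatrix _

theorem spec_interHalfSpace (A : Pencil n m) (f : E n) (b : ℝ) :
    (A.interHalfSpace f b).spec = A.spec ∩ {x | b ≤ inner ℝ f x} := by
  ext x
  have h : (A.interHalfSpace f b).eval x = (fromBlocks (A.eval x) 0 0
      (diagonal fun _ : Fin 1 => inner ℝ f x - b)).submatrix
        finSumFinEquiv.symm finSumFinEquiv.symm := by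
    ext i j
    obtain ⟨i, rfl⟩ := finSumFinEquiv.surjective i
    obtain ⟨j, rfl⟩ := finSumFinEquiv.surjective j
    rcases i with i | i <;> rcases j with j | j <;>
      simp [eval, interHalfSpace, Matrix.sum_apply, PiLp.inner_apply, sub_eq_add_neg,
        diagonal_apply, eq_iff_true_of_subsingleton]
  show ((A.interHalfSpace f b).eval x).PosSemidef ↔ (A.eval x).PosSemidef ∧ b ≤ inner ℝ f x
  rw [h, posSemidef_submatrix_equiv, posSemidef_fromBlocks_zero_iff, posSemidef_diagonal_iff]
  simp

/-- The pencil of the cone of recession directions. -/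
def homog (A : Pencil n m) : Pencil n m where
  A₀ := 0
  A := A.A
  symm₀ := isSymm_zero
  symm := A.symm

theorem eval_homog (A : Pencil n m) (x : E n) : A.homog.eval x = A.lin x := add_zero _

theorem lin_zero (A : Pencil n m) : A.lin 0 = 0 := by simp [lin]

theorem lin_sum {ι : Type*} (A : Pencil n m) (s : Finset ι) (f : ι → E n) :
    A.lin (∑ i ∈ s, f i) = ∑ i ∈ s, A.lin (f i) := by
  classical
  induction s using Finset.induction_on with
  | empty => simp [lin_zero]
  | insert i s hi ih => rw [Finset.sum_insert hi, Finset.sum_insert hi, lin_add, ih]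

/-- The pencil of the preimage of a spectrahedron under an affine map. -/
def comap {k : ℕ} (A : Pencil n m) (φ : E k →ᵃ[ℝ] E n) : Pencil k m where
  A₀ := A.eval (φ 0)
  A i := A.lin (φ.linear (EuclideanSpace.single i 1))
  symm₀ := A.isSymm_eval _
  symm _ := A.isSymm_lin _

theorem eval_comap {k : ℕ} (A : Pencil n m) (φ : E k →ᵃ[ℝ] E n) (y : E k) :
    (A.comap φ).eval y = A.eval (φ y) := by
  have hy : y = ∑ i, y i • EuclideanSpace.single i (1 : ℝ) := by
    ext j; simp [Finset.sum_apply, Pi.single_apply]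
  have hφ : φ y = φ.linear y + φ 0 := by
    have := φ.map_vadd 0 y
    simpa using this
  have hl : A.lin (φ.linear y) = ∑ i, y i • A.lin (φ.linear (EuclideanSpace.single i 1)) := by
    conv_lhs => rw [hy]
    rw [map_sum, lin_sum]
    exact Finset.sum_congr rfl fun i _ => by rw [map_smul, lin_smul]
  rw [hφ, A.eval_eq, lin_add, hl, add_assoc]
  rfl

theorem spec_comap {k : ℕ} (A : Pencil n m) (φ : E k →ᵃ[ℝ] E n) :
    (A.comap φ).spec = φ ⁻¹' A.spec := by
  ext y
  show ((A.comap φ).eval y).PosSemidef ↔ (A.eval (φ y)).PosSemidef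
  rw [eval_comap]

end Pencil

/-! ### Euclidean coordinates of affine hulls -/

section Coordinates

variable {n : ℕ}

/-- An orthonormal basis of the direction space gives the coordinates; excluding singletons makes
the dimension positive, as the cutting scheme requires. -/
theorem exists_affineIsometry_range {S : Set (E n)} (hne : S.Nonempty)
    (hS : ¬ ∃ x, S = {x}) :
    ∃ (k : ℕ) (φ : E k →ᵃⁱ[ℝ] E n), 0 < k ∧ Set.range φ = (affineSpan ℝ S : Set (E n)) := by
  obtain ⟨x₀, hx₀⟩ := hne
  have hmem : x₀ ∈ affineSpan ℝ S := subset_affineSpan ℝ S hx₀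
  let W := (affineSpan ℝ S).direction
  let e := (stdOrthonormalBasis ℝ W).repr
  let φ : E (Module.finrank ℝ W) →ᵃⁱ[ℝ] E n :=
    (AffineIsometryEquiv.vaddConst ℝ x₀).toAffineIsometry.comp
      (W.subtypeₗᵢ.comp e.symm.toLinearIsometry).toAffineIsometry
  have hφ : ∀ y, φ y = (e.symm y : E n) + x₀ := fun y => rfl
  refine ⟨Module.finrank ℝ W, φ, ?_, ?_⟩
  · rw [Module.finrank_pos_iff_exists_ne_zero]
    obtain ⟨x, hx, hxx₀⟩ : ∃ x ∈ S, x ≠ x₀ := by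
      by_contra! h
      exact hS ⟨x₀, Set.eq_singleton_iff_unique_mem.2 ⟨hx₀, h⟩⟩
    refine ⟨⟨x - x₀, AffineSubspace.vsub_mem_direction (subset_affineSpan ℝ S hx) hmem⟩, ?_⟩
    simpa [sub_eq_zero] using hxx₀
  · ext y
    constructor
    · rintro ⟨z, rfl⟩
      rw [hφ]
      exact AffineSubspace.vadd_mem_of_mem_direction (e.symm z).2 hmem
    · intro hy
      refine ⟨e ⟨y - x₀, AffineSubspace.vsub_mem_direction hy hmem⟩, ?_⟩
      rw [hφ]; simp

/-- In coordinates of its affine hull a convex set has interior points. -/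
theorem interior_preimage_nonempty {k : ℕ} {S : Set (E n)} (hS : Convex ℝ S)
    {φ : E k →ᵃⁱ[ℝ] E n} (hφ : Set.range φ = (affineSpan ℝ S : Set (E n))) :
    (interior (φ ⁻¹' S)).Nonempty := by
  have hconv : Convex ℝ (φ ⁻¹' S) := hS.affine_preimage φ.toAffineMap
  -- It remains to see that the preimage spans everything; this follows because its image spans the
  -- range of the injective map `φ`.
  rw [hconv.interior_nonempty_iff_affineSpan_eq_top]
  have himg : φ '' (φ ⁻¹' S) = S := by
    rw [Set.image_preimage_eq_inter_range, hφ]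
    exact Set.inter_eq_left.2 (subset_affineSpan ℝ S)
  have hmap : (affineSpan ℝ (φ ⁻¹' S)).map φ.toAffineMap = affineSpan ℝ S := by
    rw [AffineSubspace.map_span]
    congr 1
  rw [eq_top_iff]
  intro y _
  have hy : φ y ∈ affineSpan ℝ S := by
    have : φ y ∈ Set.range φ := ⟨y, rfl⟩
    rw [hφ] at this
    exact this
  rw [← hmap] at hy
  obtain ⟨y', hy', h⟩ := hy
  rwa [← φ.injective h]

end Coordinates

/-! ### The base of the recession cone -/

section Base

variable {n m : ℕ} {A : Pencil n m}

/-- Only an inequality: if the vector to be normalised is zero, `0⁻¹ = 0` makes `dirW A` zero. -/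
theorem norm_dirW_le_one (A : Pencil n m) : ‖dirW A‖ ≤ 1 := by
  simp only [dirW]
  rw [norm_smul, norm_inv, norm_norm]
  exact inv_mul_le_one

/-- Up to a positive factor the inner product is minus the trace of `A.lin d`. A positive
semidefinite matrix of trace zero vanishes, and then both `d` and `-d` would be recession
directions. -/
theorem inner_dirW_neg (hlf : LineFree A.spec) (hne : A.spec.Nonempty) {d : E n} (hd : d ≠ 0)
    (hd' : (A.lin d).PosSemidef) : inner ℝ (dirW A) d < 0 := by
  have htr : 0 < (A.lin d).trace := by
    refine lt_of_le_of_ne hd'.trace_nonneg fun h => hd ?_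
    have h0 : A.lin d = 0 := hd'.trace_eq_zero_iff.1 h.symm
    have h1 : d ∈ recc A.spec := (A.mem_recc_spec_iff hne).2 hd'
    have h2 : -d ∈ recc A.spec := (A.mem_recc_spec_iff hne).2 (by
      rw [A.lin_neg, h0, neg_zero]; exact .zero)
    have : d ∈ recc A.spec ∩ -recc A.spec := ⟨h1, h2⟩
    rw [hlf] at this
    exact this
  let u : E n := WithLp.toLp 2 (fun i => -(A.A i * 1).trace)
  have hu : inner ℝ u d = -(A.lin d).trace := by
    have := A.trace_lin_mul (U := 1) (w := -u) (fun i => by simp [u]) d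
    rw [mul_one, inner_neg_left] at this
    linarith
  have hu0 : u ≠ 0 := by
    rintro h
    rw [h, inner_zero_left] at hu
    linarith
  have : 0 < ‖u‖⁻¹ := inv_pos.2 (norm_pos_iff.2 hu0)
  show inner ℝ (‖u‖⁻¹ • u) d < 0
  rw [real_inner_smul_left, hu]
  exact mul_neg_of_pos_of_neg this (by linarith)

theorem mem_baseM_iff (hne : A.spec.Nonempty) {δ : ℝ} {d : E n} :
    d ∈ baseM A δ ↔ (A.lin d).PosSemidef ∧ inner ℝ (dirW A) d = -(1 + δ) :=
  and_congr (A.mem_recc_spec_iff hne) Iff.rfl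

theorem baseM_eq (hne : A.spec.Nonempty) (δ : ℝ) :
    baseM A δ = A.homog.spec ∩ {x | inner ℝ (dirW A) x = -(1 + δ)} := by
  ext d
  rw [mem_baseM_iff hne, ← A.eval_homog]
  rfl

theorem isCompact_baseM (hlf : LineFree A.spec) (hne : A.spec.Nonempty) (δ : ℝ) :
    IsCompact (baseM A δ) := by
  rw [baseM_eq hne]
  refine (A.homog.isCompact_spec_inter (fun d hd hd' => inner_dirW_neg hlf hne hd hd')
    (-(1 + δ))).of_isClosed_subset
    (A.homog.isClosed_spec.inter (isClosed_eq (by fun_prop) continuous_const)) ?_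
  rintro x ⟨h1, h2⟩
  exact ⟨h1, ge_of_eq h2⟩

theorem convex_baseM (hne : A.spec.Nonempty) (δ : ℝ) : Convex ℝ (baseM A δ) := by
  rw [baseM_eq hne]
  exact A.homog.convex_spec.inter (convex_hyperplane (innerSL ℝ (dirW A)).toLinearMap.isLinear _)

/-- Every nonzero recession direction has a positive multiple in the base. -/
theorem exists_smul_mem_baseM (hlf : LineFree A.spec) (hne : A.spec.Nonempty) {δ : ℝ}
    (hδ : 0 < δ) {d : E n} (hd : d ≠ 0) (hd' : (A.lin d).PosSemidef) :
    ∃ t : ℝ, 0 < t ∧ t • d ∈ baseM A δ := by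
  have hneg := inner_dirW_neg hlf hne hd hd'
  refine ⟨(1 + δ) / -inner ℝ (dirW A) d, div_pos (by linarith) (by linarith), ?_⟩
  rw [mem_baseM_iff hne, A.lin_smul, inner_smul_right]
  refine ⟨hd'.smul (div_nonneg (by linarith) (by linarith)), ?_⟩
  rw [div_neg, neg_mul, div_mul_cancel₀ _ hneg.ne]

theorem nonempty_baseM (hlf : LineFree A.spec) (hne : A.spec.Nonempty)
    (hub : ¬ Bornology.IsBounded A.spec) {δ : ℝ} (hδ : 0 < δ) : (baseM A δ).Nonempty := by
  obtain ⟨x₀, hx₀⟩ := hne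
  obtain ⟨d, hd, hray⟩ := exists_ray_of_not_isBounded A.isClosed_spec A.convex_spec hub hx₀
  obtain ⟨t, -, ht⟩ := exists_smul_mem_baseM hlf ⟨x₀, hx₀⟩ hδ hd (A.posSemidef_lin_of_ray hray)
  exact ⟨_, ht⟩

/-- In coordinates of the affine hull the hyperplane equation is automatic, so the homogeneous
pencil alone represents `M` there. -/
theorem inner_dirW_of_mem_affineSpan {δ : ℝ} {x : E n} (hx : x ∈ affineSpan ℝ (baseM A δ)) :
    inner ℝ (dirW A) x = -(1 + δ) := by
  refine affineSpan_induction (p := fun x => inner ℝ (dirW A) x = -(1 + δ)) hx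
    (fun x hx => hx.2) fun c u v w hu hv hw => ?_
  simp only [vsub_eq_sub, vadd_eq_add, inner_add_right, inner_smul_right, inner_sub_right,
    hu, hv, hw]
  ring

end Base

/-! ### Termination of the algorithm -/

section Algorithm

variable {n m : ℕ} {A : Pencil n m} {ε δ : ℝ}

/-- The algorithm has returned. -/
def AlgState.IsReturned (s : AlgState n) : Prop := ∃ V D, s = .returned V D

theorem terminates_returned (V D : List (E n)) :
    Terminates (AlgStep A ε δ) AlgState.IsReturned (.returned V D) :=
  .intro (Or.inl ⟨V, D, rfl⟩) (by rintro _ ⟨⟩)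

theorem terminates_cutC (D : List (E n)) {l : ℕ} {B : Pencil n l} {s : CutState n l}
    (h : Terminates (CutStep B ε) (CutState.IsOuter B) s) :
    Terminates (AlgStep A ε δ) AlgState.IsReturned (.cutC D B s) := by
  induction h with
  | intro progress _ ih =>
    refine .intro (Or.inr ?_) ?_
    · rcases progress with ⟨V, rfl, -⟩ | ⟨s', hs'⟩
      · exact ⟨_, .ret rfl⟩
      · exact ⟨_, .stepC hs'⟩
    · intro s' hs'
      cases hs' with
      | stepC h => exact ih _ h
      | ret _ => exact terminates_returned _ _

theorem terminates_cutM {k l : ℕ} {φ : E k →ᵃⁱ[ℝ] E n} {B : Pencil k l} {s : CutState k l}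
    (h : Terminates (CutStep B (δ / 2)) (CutState.IsOuter B) s)
    (hend : ∀ V : List (E k), B.spec ⊆ convexHull ℝ {x | x ∈ V} →
      Terminates (AlgStep A ε δ) AlgState.IsReturned (.approxM (V.map φ))) :
    Terminates (AlgStep A ε δ) AlgState.IsReturned (.cutM φ B s) := by
  induction h with
  | intro progress _ ih =>
    refine .intro (Or.inr ?_) ?_
    · rcases progress with ⟨V, rfl, -⟩ | ⟨s', hs'⟩
      · exact ⟨_, .endM⟩
      · exact ⟨_, .stepM hs'⟩
    · intro s' hs'
      cases hs' with
      | stepM h => exact ih _ h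
      | endM =>
        -- A `done` state has no successor, so it must be final, and finality carries the outer
        -- approximation property.
        rcases progress with ⟨V, hV, hsub⟩ | ⟨_, hs'⟩
        · cases hV
          exact hend _ hsub
        · cases hs'

/-- The point `x` is a limit of interior points, and those close to it still satisfy the strict
inequality. The slack `ε` in the truncation of `C` supplies that strictness. -/
theorem interior_spec_inter_nonempty (hint : (interior A.spec).Nonempty) {f x : E n} {b : ℝ}
    (hx : x ∈ A.spec) (hb : b < inner ℝ f x) :
    (interior (A.spec ∩ {x | b ≤ inner ℝ f x})).Nonempty := by
  have hcl : x ∈ closure (interior A.spec) := by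
    rw [A.convex_spec.closure_interior_eq_closure_of_nonempty_interior hint]
    exact subset_closure hx
  have hopen : IsOpen {x | b < inner ℝ f x} := isOpen_lt continuous_const (by fun_prop)
  obtain ⟨y, hy1, hy2⟩ := mem_closure_iff.1 hcl _ hopen hb
  refine ⟨y, mem_interior.2 ⟨interior A.spec ∩ {x | b < inner ℝ f x}, ?_,
    isOpen_interior.inter hopen, hy2, hy1⟩⟩
  rintro z ⟨hz1, hz2⟩
  exact ⟨interior_subset hz1, LT.lt.le (show b < inner ℝ f z from hz2)⟩

theorem terminates_rows (hn : 0 < n) (hlf : LineFree A.spec) (hint : (interior A.spec).Nonempty)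
    (hε : 0 < ε) (D todo : List (E n)) : ∀ sols : List (E n),
    (∀ r ∈ todo, ∀ d, d ≠ 0 → (A.lin d).PosSemidef → inner ℝ r d < 0) →
    (∀ x ∈ sols, x ∈ A.spec) → (todo ≠ [] ∨ sols ≠ []) →
    Terminates (AlgStep A ε δ) AlgState.IsReturned (.rows D todo sols) := by
  have hne : A.spec.Nonempty := hint.mono interior_subset
  induction todo with
  | nil =>
    intro sols _ hsols hne'
    refine .intro (Or.inr ?_) ?_
    · obtain ⟨x, hx, hmin⟩ := (List.finite_toSet sols).exists_minimalFor
        (fun x => inner ℝ (dirW A) x) _ (List.exists_mem_of_ne_nil sols (by simpa using hne'))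
      refine ⟨_, .startC (β := inner ℝ (dirW A) x) ⟨⟨x, hx, rfl⟩, ?_⟩
        (A.spec_interHalfSpace (dirW A) _)⟩
      rintro _ ⟨y, hy, rfl⟩
      rcases le_total (inner ℝ (dirW A) x) (inner ℝ (dirW A) y) with h | h
      · exact h
      · exact hmin hy h
    · intro s' hs'
      cases hs' with
      | startC hβ hB =>
        obtain ⟨x, hx, hxβ⟩ := hβ.1
        refine terminates_cutC D (terminates_start hn ?_ ?_ hε)
        · rw [hB]
          exact A.isCompact_spec_inter (fun d hd hd' => inner_dirW_neg hlf hne hd hd') _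
        · rw [hB]
          exact interior_spec_inter_nonempty hint (hsols x hx) (by linarith)
  | cons r todo ih =>
    intro sols htodo hsols _
    refine .intro (Or.inr ?_) ?_
    · obtain ⟨x₀, hx₀⟩ := hne
      obtain ⟨x, hx⟩ := A.exists_solP1 hx₀
        (A.isCompact_spec_inter (htodo r List.mem_cons_self) _)
      exact ⟨_, .solveRow hx⟩
    · intro s' hs'
      cases hs' with
      | solveRow h =>
        refine ih _ (fun r hr => htodo r (List.mem_cons_of_mem _ hr)) ?_ (Or.inr (by simp))
        intro x hx
        rcases List.mem_cons.1 hx with rfl | hx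
        · exact h.1
        · exact hsols x hx

theorem terminates_cone (hn : 0 < n) (hlf : LineFree A.spec) (hint : (interior A.spec).Nonempty)
    (hub : ¬ Bornology.IsBounded A.spec) (hε : 0 < ε) (hδ : 0 < δ) {D : List (E n)}
    (hD : ∀ d ∈ baseM A δ, ∀ b ∈ oneBall n (δ / 2), d + b ∈ coneHull {x | x ∈ D})
    (hDneg : ∀ d ∈ D, inner ℝ (dirW A) d ≤ 0) :
    Terminates (AlgStep A ε δ) AlgState.IsReturned (.cone D) := by
  have hne : A.spec.Nonempty := hint.mono interior_subset
  refine .intro (Or.inr ?_) ?_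
  · obtain ⟨R, hR₀, hR⟩ := exists_list_polar_coneHull D
    exact ⟨_, .hrep hR₀ hR⟩
  · intro s' hs'
    cases hs' with
    | @hrep _ R hR₀ hR =>
      refine terminates_rows hn hlf hint hε D R [] ?_ (by simp) (Or.inl ?_)
      · intro r hr d hd hd'
        obtain ⟨t, ht, htd⟩ := exists_smul_mem_baseM hlf hne hδ hd hd'
        obtain ⟨s, hs, hsr⟩ := exists_pos_smul_mem_oneBall (half_pos hδ) r
        -- `K` contains `t • d` moved slightly along `r`; since `⟨r, r⟩ > 0`, the inequality for `r`
        -- must be strict at `d`.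
        have h1 := hD _ htd _ hsr
        rw [← hR] at h1
        have h2 := h1 r hr
        rw [inner_add_right, inner_smul_right, inner_smul_right] at h2
        have h3 : 0 < inner ℝ r r := real_inner_self_pos.2 (hR₀ r hr)
        have h4 : 0 < s * inner ℝ r r := mul_pos hs h3
        exact neg_of_mul_neg_right (by linarith) ht.le
      -- Without rows `K` would be the whole space, but `dirW A` is nonpositive on `K` and positive
      -- at `-d`.
      · rintro rfl
        obtain ⟨d, hd⟩ := nonempty_baseM hlf hne hub hδ
        have h1 : -d ∈ coneHull {x | x ∈ D} := by rw [← hR]; simp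
        have h2 : ∀ y ∈ coneHull {x | x ∈ D}, inner ℝ (dirW A) y ≤ 0 := by
          intro y hy
          refine Submodule.span_induction (p := fun y _ => inner ℝ (dirW A) y ≤ 0) hDneg
            (by simp) (fun x y _ _ hx hy => ?_) (fun t x _ hx => ?_) hy
          · rw [inner_add_right]; linarith
          · have : inner ℝ (dirW A) ((t : ℝ) • x) ≤ 0 := by
              rw [inner_smul_right]; exact mul_nonpos_of_nonneg_of_nonpos t.2 hx
            exact this
        have h3 := h2 _ h1
        have h4 : inner ℝ (dirW A) d = -(1 + δ) := hd.2
        rw [inner_neg_right] at h3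
        linarith

theorem terminates_approxM (hn : 0 < n) (hlf : LineFree A.spec)
    (hint : (interior A.spec).Nonempty) (hub : ¬ Bornology.IsBounded A.spec) (hε : 0 < ε)
    (hδ : 0 < δ) {V : List (E n)} (hV : baseM A δ ⊆ convexHull ℝ {x | x ∈ V})
    (hVeq : ∀ v ∈ V, inner ℝ (dirW A) v = -(1 + δ)) :
    Terminates (AlgStep A ε δ) AlgState.IsReturned (.approxM V) := by
  refine .intro (Or.inr ?_) ?_
  · obtain ⟨D, hD⟩ := exists_enumerates (finite_extremePoints_convexHull_add_oneBall V (δ / 2))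
    exact ⟨_, .enlarge hD⟩
  · intro s' hs'
    cases hs' with
    | @enlarge _ D hD =>
      refine terminates_cone hn hlf hint hub hε hδ ?_ ?_
      · intro d hd b hb
        refine convexHull_subset_coneHull _ ?_
        rw [hD.convexHull_eq
          (((List.finite_toSet V).isCompact_convexHull ℝ).add (isCompact_oneBall n _))
          ((convex_convexHull ℝ _).add (convex_oneBall n _))]
        exact Set.add_mem_add (hV hd) hb
      · intro d hd
        have hd' : d ∈ Set.extremePoints ℝ (convexHull ℝ {x | x ∈ V} + oneBall n (δ / 2)) := by
          rw [← hD]; exact hd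
        obtain ⟨x, hx, b, hb, rfl⟩ := Set.mem_add.1 hd'.1
        have hx' : inner ℝ (dirW A) x = -(1 + δ) :=
          convexHull_min (t := {x | inner ℝ (dirW A) x = -(1 + δ)}) hVeq
            (convex_hyperplane (innerSL ℝ (dirW A)).toLinearMap.isLinear _) hx
        -- The enlargement raises `dirW A` by at most `δ / 2`, so the value stays below `-(1 + δ) +
        -- δ / 2 < 0`.
        have hb' : inner ℝ (dirW A) b ≤ δ / 2 :=
          calc inner ℝ (dirW A) b ≤ ‖dirW A‖ * ‖b‖ := real_inner_le_norm _ _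
            _ ≤ 1 * ‖b‖ := by gcongr; exact norm_dirW_le_one A
            _ ≤ δ / 2 := by rw [one_mul]; exact norm_le_of_mem_oneBall hb
        rw [inner_add_right]
        linarith

theorem terminates_algorithm (hub : ¬ Bornology.IsBounded A.spec) (hlf : LineFree A.spec)
    (hint : (interior A.spec).Nonempty) (hε : 0 < ε) (hδ : 0 < δ) :
    Terminates (AlgStep A ε δ) AlgState.IsReturned .start := by
  have hne : A.spec.Nonempty := hint.mono interior_subset
  have hn : 0 < n := by
    rcases Nat.eq_zero_or_pos n with rfl | h
    -- In dimension zero every set is finite, hence bounded.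
    · exact absurd (A.spec.toFinite.isBounded) hub
    · exact h
  refine .intro (Or.inr ?_) ?_
  · by_cases hx : ∃ x, baseM A δ = {x}
    · obtain ⟨x, hx⟩ := hx
      exact ⟨_, .pointM hx⟩
    · obtain ⟨k, φ, hk, hφ⟩ := exists_affineIsometry_range (nonempty_baseM hlf hne hub hδ) hx
      refine ⟨_, .startM hk hφ (B := A.homog.comap φ.toAffineMap) ?_⟩
      rw [A.homog.spec_comap, baseM_eq hne]
      ext y
      refine ⟨fun hy => ⟨hy, inner_dirW_of_mem_affineSpan ?_⟩, fun hy => hy.1⟩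
      rw [← SetLike.mem_coe, ← hφ]
      exact ⟨y, rfl⟩
  · intro s' hs'
    cases hs' with
    | @startM k l φ B hk hφ hB =>
      have hspan : ∀ y, φ y ∈ affineSpan ℝ (baseM A δ) := fun y => by
        rw [← SetLike.mem_coe, ← hφ]; exact ⟨y, rfl⟩
      refine terminates_cutM (terminates_start hk ?_ ?_ (half_pos hδ)) fun V hV => ?_
      · rw [hB]
        exact φ.isometry.isClosedEmbedding.isCompact_preimage (isCompact_baseM hlf hne δ)
      · rw [hB]
        exact interior_preimage_nonempty (convex_baseM hne δ) hφ
      · refine terminates_approxM hn hlf hint hub hε hδ ?_ ?_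
        · intro x hx
          obtain ⟨y, rfl⟩ : x ∈ Set.range φ := by
            rw [hφ]; exact subset_affineSpan ℝ _ hx
          have hy : y ∈ convexHull ℝ {x | x ∈ V} := hV (by rw [hB]; exact hx)
          have h1 : φ y ∈ φ.toAffineMap '' convexHull ℝ {x | x ∈ V} := ⟨y, hy, rfl⟩
          rw [AffineMap.image_convexHull] at h1
          refine convexHull_mono ?_ h1
          rintro _ ⟨v, hv, rfl⟩
          exact List.mem_map.2 ⟨v, hv, rfl⟩
        · intro v hv
          obtain ⟨y, -, rfl⟩ := List.mem_map.1 hv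
          exact inner_dirW_of_mem_affineSpan (hspan y)
    | @pointM x hx =>
      refine terminates_approxM hn hlf hint hub hε hδ ?_ ?_
      · rw [hx]
        simp
      · intro v hv
        have : v ∈ baseM A δ := by rw [hx]; simpa using hv
        exact this.2

end Algorithm

end SpecApprox

end

theorem mainTheorem10 {n m : ℕ} (A : SpecApprox.Pencil n m)
    (hunbounded : ¬ Bornology.IsBounded A.spec)
    (hlineFree : SpecApprox.LineFree A.spec)
    (hinterior : (interior A.spec).Nonempty)
    (ε δ : ℝ) (hε : 0 < ε) (hδ : 0 < δ) :
    -- there is no infinite run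
    (¬ ∃ s : ℕ → SpecApprox.AlgState n, s 0 = .start ∧
      ∀ i, SpecApprox.AlgStep A ε δ (s i) (s (i + 1))) ∧
    -- and no run gets stuck before it returns
    (∀ s : SpecApprox.AlgState n,
      Relation.ReflTransGen (SpecApprox.AlgStep A ε δ) .start s →
        (∃ V D, s = .returned V D) ∨ ∃ s', SpecApprox.AlgStep A ε δ s s') := by
  have h := SpecApprox.terminates_algorithm hunbounded hlineFree hinterior hε hδ
  exact ⟨h.not_exists_run, fun s hs => h.final_or_step_of_reflTransGen hs⟩
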